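/- **Setting.** A combinatorial problem $A$ consists of instances; an instance $I$ (given to a machine by some description) has a ground set $U$ of $n$ elements and a family $\mathcal F\subseteq 2^U$ of feasible solutions. The exact version of $A$ asks, for an instance, nonnegative integer weights $(a_e)_{e\in U}$ and an integer target $K\ge 0$, whether some $S\in\mathcal F$ has $\sum_{e\in S}a_e=K$; it is pseudopolynomially solvable if it is decided in time polynomial in $n$ and $t=\max(K,\max_e a_e)$. Algorithms are real-RAM programs (list operations, exact real arithmetic $+,-,\times,\div$ and comparisons at unit cost; only rational constants; no floor function and no transcendental operations). For $\phi\in\mathbb C$ with a fixed argument $\theta$, that is, $\phi=|\phi|e^{i\theta}$, put $\phi^x=|\phi|^xe^{i\theta x}$ for real $x\ge 0$ (with $0^0=1$). **Theorem.** Suppose the exact version of $A$ is pseudopolynomially solvable. Then there is a constant $D$, depending only on $A$, such that the following holds for every $L\ge 1$. There is an algorithm such that for all complex numbers $c_1,\dots,c_L$, $\phi_1,\dots,\phi_L$ with $|\phi_k|\le 1$ and all choices of arguments of the $\phi_k$, with $\widetilde\mu(x)=\sum_{k=1}^L c_k\phi_k^x$, there is a constant $C$ such that for every $\varepsilon>0$,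 every instance of $A$ with $\mathcal F\neq\emptyset$, and all independent, almost surely nonnegative random weights $(w_e)_{e\in U}$, the algorithm, given the description of the instance, $\varepsilon$, the $c_k$ and the numbers $\mathbb E[\phi_k^{w_e}]$ ($e\in U$, $1\le k\le L$), halts after at most $$C\left(\frac{\max(1,n)}{\min(1,\varepsilon)}\right)^{D L}=(n/\varepsilon)^{O(L)}$$ steps and outputs a solution $S\in\mathcal F$ such that $$\Bigl|\,\bigl|\mathbb E[\widetilde\mu(w(S))]\bigr|-\bigl|\mathbb E[\widetilde\mu(w(\widetilde S))]\bigr|\,\Bigr|<\varepsilon ,$$ where $w(S)=\sum_{e\in S}w_e$ and $\widetilde S$ is any maximizer of $|\mathbb E[\widetilde\mu(w(S'))]|$ over $S'\in\mathcal F$. -/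

import Mathlib

open MeasureTheory ProbabilityTheory

universe u v

/-! ### The machine model

A real RAM without floor function and without transcendental operations, presented as a structured
list-processing language.  A memory value is a binary tree with real numbers in its leaves.
Every primitive (pointer operation, exact arithmetic operation, comparison of two reals,
rational constant) and every control step costs one unit of time. -/

/-- Memory values: the empty value, a real number, or a pair of two values. -/
inductive Val : Type
  | nil : Val
  | num (x : ℝ) : Val
  | pair (a b : Val) : Val

namespace Val

/-- First component (`nil` on everything that is not a pair). -/
def fst : Val → Val
  | pair a _ => a
  | _ => nil

/-- Second component (`nil` on everything that is not a pair). -/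
def snd : Val → Val
  | pair _ b => b
  | _ => nil

/-- Booleans: `nil` is false, every other value is true. -/
noncomputable def ofProp (P : Prop) : Val :=
  open Classical in if P then num 1 else nil

/-- Apply an arithmetic operation to a pair of two numbers (`nil` on every other input). -/
def arith (f : ℝ → ℝ → ℝ) : Val → Val
  | pair (num x) (num y) => num (f x y)
  | _ => nil

/-- Compare the two numbers of a pair (false on every other input). -/
noncomputable def less : Val → Val
  | pair (num x) (num y) => ofProp (x < y)
  | _ => nil

/-- Is the value a pair? -/
noncomputable def isPair : Val → Val
  | pair _ _ => num 1
  | _ => nil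

/-- A list of values as one value. -/
def ofList : List Val → Val
  | [] => nil
  | a :: l => pair a (ofList l)

/-- A finite sequence of values as one value. -/
def ofSeq {n : ℕ} (f : Fin n → Val) : Val := ofList (List.ofFn f)

/-- A complex number as the pair of its real and imaginary parts. -/
noncomputable def ofComplex (z : ℂ) : Val := pair (num z.re) (num z.im)

/-- A subset of `Fin n` as its 0-1 indicator list. -/
noncomputable def ofSet {n : ℕ} (S : Finset (Fin n)) : Val :=
  ofSeq fun e => num (if e ∈ S then 1 else 0)

end Val

/-- Programs.  A program maps one value to one value. The only constants are rational numbers. -/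
inductive Prog : Type
  | id : Prog
  | nil : Prog
  | const (q : ℚ) : Prog
  | fst : Prog
  | snd : Prog
  | isPair : Prog
  | add : Prog
  | sub : Prog
  | mul : Prog
  | div : Prog
  | less : Prog
  | pair (p q : Prog) : Prog
  /-- first `p`, then `q` -/
  | seq (p q : Prog) : Prog
  /-- if `c` then `p` else `q` -/
  | cond (c p q : Prog) : Prog
  /-- while `c` do `p` -/
  | loop (c p : Prog) : Prog

/-- `Runs p v r t`: the program `p`, started on `v`, halts with the result `r` after exactly
`t` steps. (A division by zero has the result zero.) -/
inductive Runs : Prog → Val → Val → ℕ → Prop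
  | id (v : Val) : Runs .id v v 1
  | nil (v : Val) : Runs .nil v .nil 1
  | const (q : ℚ) (v : Val) : Runs (.const q) v (.num (q : ℝ)) 1
  | fst (v : Val) : Runs .fst v v.fst 1
  | snd (v : Val) : Runs .snd v v.snd 1
  | isPair (v : Val) : Runs .isPair v v.isPair 1
  | add (v : Val) : Runs .add v (v.arith fun x y => x + y) 1
  | sub (v : Val) : Runs .sub v (v.arith fun x y => x - y) 1
  | mul (v : Val) : Runs .mul v (v.arith fun x y => x * y) 1
  | div (v : Val) : Runs .div v (v.arith fun x y => x / y) 1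
  | less (v : Val) : Runs .less v v.less 1
  | pair {p q : Prog} {v a b : Val} {s t : ℕ} :
      Runs p v a s → Runs q v b t → Runs (.pair p q) v (.pair a b) (s + t + 1)
  | seq {p q : Prog} {v a b : Val} {s t : ℕ} :
      Runs p v a s → Runs q a b t → Runs (.seq p q) v b (s + t + 1)
  | cond_true {c p q : Prog} {v a b : Val} {s t : ℕ} :
      Runs c v a s → a ≠ .nil → Runs p v b t → Runs (.cond c p q) v b (s + t + 1)
  | cond_false {c p q : Prog} {v b : Val} {s t : ℕ} :
      Runs c v .nil s → Runs q v b t → Runs (.cond c p q) v b (s + t + 1)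
  | loop_done {c p : Prog} {v : Val} {s : ℕ} :
      Runs c v .nil s → Runs (.loop c p) v v (s + 1)
  | loop_step {c p : Prog} {v a b r : Val} {s t k : ℕ} :
      Runs c v a s → a ≠ .nil → Runs p v b t → Runs (.loop c p) b r k →
      Runs (.loop c p) v r (s + t + k + 1)

/-! ### Combinatorial problems -/

/-- A combinatorial problem: every instance has a ground set of `n` elements, a family of feasible
subsets of the ground set, and a description by which it is given to a machine. -/
structure CombProblem where
  Inst : Type u
  n : Inst → ℕ
  feas : (i : Inst) → Set (Finset (Fin (n i)))
  descr : Inst → Val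

/-- The input of the exact version: an instance, a nonnegative integer weight for every element,
and a target. -/
noncomputable def exactInput (A : CombProblem.{u}) (i : A.Inst) (w : Fin (A.n i) → ℕ) (K : ℕ) :
    Val :=
  .pair (A.descr i) (.pair (.ofSeq fun e => .num (w e : ℝ)) (.num (K : ℝ)))

/-- The exact version of `A` (is there a feasible solution of total weight exactly `K`?) is decided
by a program in time polynomial in `n` and in the largest integer `t` of the input. -/
def ExactPseudopoly (A : CombProblem.{u}) : Prop :=
  ∃ (p : Prog) (a d : ℕ), ∀ (i : A.Inst) (w : Fin (A.n i) → ℕ) (K : ℕ),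
    ∃ (r : Val) (t : ℕ), Runs p (exactInput A i w K) r t ∧
      (r ≠ .nil ↔ ∃ S ∈ A.feas i, ∑ e ∈ S, w e = K) ∧
      t ≤ a * (A.n i + max K (Finset.univ.sup w) + 1) ^ d

/-! ### Exponential sums and expected utility -/

/-- The power `φ ^ x` of a complex number for real `x ≥ 0`, formed with the argument `θ` of `φ`. -/
noncomputable def powArg (φ : ℂ) (θ : ℝ) (x : ℝ) : ℂ :=
  ((‖φ‖ ^ x : ℝ) : ℂ) * Complex.exp ((θ * x : ℝ) * Complex.I)

/-- The exponential sum `∑ k, c k * φ k ^ x`. -/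
noncomputable def expSum {L : ℕ} (c φ : Fin L → ℂ) (θ : Fin L → ℝ) (x : ℝ) : ℂ :=
  ∑ k, c k * powArg (φ k) (θ k) x

/-- The expected utility of the solution `S` under random weights `w`. -/
noncomputable def expectedUtility {Ω : Type v} [MeasurableSpace Ω] (P : Measure Ω) {n : ℕ}
    (w : Fin n → Ω → ℝ) (μ : ℝ → ℂ) (S : Finset (Fin n)) : ℂ :=
  ∫ ω, μ (∑ e ∈ S, w e ω) ∂P

/-- The input of the utility maximization algorithm: an instance, the accuracy `ε`, the
coefficients of the exponential sum, and for every element `e` the list of the numbers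
`𝔼[φ k ^ w e]`. -/
noncomputable def eumInput {Ω : Type v} [MeasurableSpace Ω] (P : Measure Ω)
    (A : CombProblem.{u}) (i : A.Inst) (w : Fin (A.n i) → Ω → ℝ)
    {L : ℕ} (c φ : Fin L → ℂ) (θ : Fin L → ℝ) (ε : ℝ) : Val :=
  .pair (A.descr i) (.pair (.num ε) (.pair (.ofSeq fun k => .ofComplex (c k))
    (.ofSeq fun e => .ofSeq fun k => .ofComplex (∫ ω, powArg (φ k) (θ k) (w e ω) ∂P))))

/-! Put `α e k = 𝔼[φ k ^ w e]`. Since the weights are almost surely nonnegative and independent,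
powers of sums become products of expectations, and the expected utility of `S` is `∑ k, c k * ∏ e ∈
S, α e k` (`expectedUtility_expSum`), where all `α e k` lie in the closed unit disc. So only the
given expectations matter.

To use an exact oracle, these products must be turned into sums of integers. Rounding logarithms and
arguments would need transcendental operations. Instead, every `α e k` is approximated by a power of
the single number `1 / (1 - δ * I)`, whose coordinates are rational in `δ`. Its powers run along a
logarithmic spiral with angular step about `δ` and radial step of order `δ ^ 2`, so consecutive
windings are `O(δ)` apart. Hence the first `O(δ ^ (-3))` powers come within `10 * δ` of every point
of the disc (`exists_spiral_pow_near`), and the exponent can be found by trying one power after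
another.

The product over `S` is then close to a power whose exponent is a sum of integers over `S`.
Solutions with the same `L` exponent sums have nearly the same value (`norm_solutionValue_sub_le`).
The `L` exponents of an element are packed as digits of one integer in a base so large that no sum
over elements carries (`sum_digit_eq_of_sum_ofDigits_eq`). One target for the exact version
therefore fixes all `L` sums.

The algorithm tries every target `K` below `X = 1 + ∑ e, packWeight δ α e`. If the oracle says that
`K` is attained, self-reduction constructs one solution of weight `K` (`runsIn_chooseSolution`); its
value is computed exactly from the expectations and the best solution is kept (`runsIn_searchBest`).
The solution tried at the optimum's weight is within `ε` of the optimum, and the output is at least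
as good. With `δ` of order `ε / n` for fixed coefficients, `X` is bounded by a power of `n / ε` with
exponent linear in `L`, and so is the running time. -/

/-! ### Running programs within a time bound -/

/-- The program `p` maps `v` to `r` in at most `T` steps. -/
def RunsIn (p : Prog) (v r : Val) (T : ℕ) : Prop := ∃ t ≤ T, Runs p v r t

namespace RunsIn

theorem mono {p : Prog} {v r : Val} {S T : ℕ} (h : RunsIn p v r S) (hST : S ≤ T) :
    RunsIn p v r T := by
  obtain ⟨t, ht, h⟩ := h
  exact ⟨t, ht.trans hST, h⟩

theorem seq {p q : Prog} {v a b : Val} {S T : ℕ} (h : RunsIn p v a S) (h' : RunsIn q a b T) :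
    RunsIn (.seq p q) v b (S + T + 1) := by
  obtain ⟨s, hs, h⟩ := h
  obtain ⟨t, ht, h'⟩ := h'
  exact ⟨s + t + 1, by omega, .seq h h'⟩

theorem pair {p q : Prog} {v a b : Val} {S T : ℕ} (h : RunsIn p v a S) (h' : RunsIn q v b T) :
    RunsIn (.pair p q) v (.pair a b) (S + T + 1) := by
  obtain ⟨s, hs, h⟩ := h
  obtain ⟨t, ht, h'⟩ := h'
  exact ⟨s + t + 1, by omega, .pair h h'⟩

theorem cond_true {c p q : Prog} {v a b : Val} {S T : ℕ} (h : RunsIn c v a S) (ha : a ≠ .nil)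
    (h' : RunsIn p v b T) : RunsIn (.cond c p q) v b (S + T + 1) := by
  obtain ⟨s, hs, h⟩ := h
  obtain ⟨t, ht, h'⟩ := h'
  exact ⟨s + t + 1, by omega, .cond_true h ha h'⟩

theorem cond_false {c p q : Prog} {v b : Val} {S T : ℕ} (h : RunsIn c v .nil S)
    (h' : RunsIn q v b T) : RunsIn (.cond c p q) v b (S + T + 1) := by
  obtain ⟨s, hs, h⟩ := h
  obtain ⟨t, ht, h'⟩ := h'
  exact ⟨s + t + 1, by omega, .cond_false h h'⟩

theorem loop_done {c p : Prog} {v : Val} {S : ℕ} (h : RunsIn c v .nil S) :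
    RunsIn (.loop c p) v v (S + 1) := by
  obtain ⟨s, hs, h⟩ := h
  exact ⟨s + 1, by omega, .loop_done h⟩

theorem loop_step {c p : Prog} {v a b r : Val} {S T K : ℕ} (h : RunsIn c v a S) (ha : a ≠ .nil)
    (h' : RunsIn p v b T) (h'' : RunsIn (.loop c p) b r K) :
    RunsIn (.loop c p) v r (S + T + K + 1) := by
  obtain ⟨s, hs, h⟩ := h
  obtain ⟨t, ht, h'⟩ := h'
  obtain ⟨k, hk, h''⟩ := h''
  exact ⟨s + t + k + 1, by omega, .loop_step h ha h' h''⟩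

/-- A loop with an invariant and an iteration count known in advance. -/
theorem loop {c p : Prog} {S T : ℕ} (N : ℕ) (Inv : ℕ → Val → Prop)
    (hstep : ∀ k < N, ∀ v, Inv k v →
      (∃ a ≠ .nil, RunsIn c v a S) ∧ ∃ v', RunsIn p v v' T ∧ Inv (k + 1) v')
    (hdone : ∀ v, Inv N v → RunsIn c v .nil S) (v : Val) (hv : Inv 0 v) :
    ∃ r, RunsIn (.loop c p) v r ((N + 1) * (S + T + 1)) ∧ Inv N r := by
  induction N generalizing Inv v with
  | zero => exact ⟨v, (loop_done (hdone v hv)).mono (by nlinarith), hv⟩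
  | succ N ih =>
    obtain ⟨⟨a, ha, hc⟩, v', hp, hv'⟩ := hstep 0 (by omega) v hv
    obtain ⟨r, hr, hI⟩ := ih (fun k => Inv (k + 1))
      (fun k hk => hstep (k + 1) (by omega)) hdone v' hv'
    exact ⟨r, (loop_step hc ha hp hr).mono (by nlinarith), hI⟩

end RunsIn

/-! ### Evaluation of loop-free programs. -/

namespace Prog

/-- The result of a loop-free program. -/
noncomputable def eval : Prog → Val → Val
  | .id, v => v
  | .nil, _ => .nil
  | .const q, _ => .num (q : ℝ)
  | .fst, v => v.fst
  | .snd, v => v.snd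
  | .isPair, v => v.isPair
  | .add, v => v.arith fun x y => x + y
  | .sub, v => v.arith fun x y => x - y
  | .mul, v => v.arith fun x y => x * y
  | .div, v => v.arith fun x y => x / y
  | .less, v => v.less
  | .pair p q, v => .pair (p.eval v) (q.eval v)
  | .seq p q, v => q.eval (p.eval v)
  | .cond c p q, v => open Classical in if c.eval v = .nil then q.eval v else p.eval v
  | .loop _ _, v => v

/-- A bound for the running time of a loop-free program. -/
def cost : Prog → ℕ
  | .pair p q => p.cost + q.cost + 1
  | .seq p q => p.cost + q.cost + 1
  | .cond c p q => c.cost + (p.cost + q.cost) + 1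
  | _ => 1

/-- The program contains no loop. -/
def loopFree : Prog → Bool
  | .pair p q => p.loopFree && q.loopFree
  | .seq p q => p.loopFree && q.loopFree
  | .cond c p q => c.loopFree && p.loopFree && q.loopFree
  | .loop _ _ => false
  | _ => true

/-- This reduces straight-line code to computation: the result is obtained by `rfl` or `simp`, the
cost by `decide`. A conditional is charged for both branches, so the cost does not depend on the
input. -/
theorem runsIn_eval (p : Prog) (hp : p.loopFree = true) (v : Val) :
    RunsIn p v (p.eval v) p.cost := by
  induction p generalizing v with
  | pair p q hp' hq' =>
    simp only [loopFree, Bool.and_eq_true] at hp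
    exact (hp' hp.1 v).pair (hq' hp.2 v)
  | seq p q hp' hq' =>
    simp only [loopFree, Bool.and_eq_true] at hp
    exact (hp' hp.1 v).seq (hq' hp.2 _)
  | cond c p q hc' hp' hq' =>
    simp only [loopFree, Bool.and_eq_true] at hp
    have hc := hc' hp.1.1 v
    by_cases h : c.eval v = .nil
    · rw [h] at hc
      simp only [eval, h, if_true, cost]
      exact (RunsIn.cond_false hc (hq' hp.2 v)).mono (by omega)
    · simp only [eval, h, if_false, cost]
      exact (RunsIn.cond_true hc h (hp' hp.1.2 v)).mono (by omega)
  | loop c p => simp [loopFree] at hp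
  | id => exact ⟨1, le_rfl, .id v⟩
  | nil => exact ⟨1, le_rfl, .nil v⟩
  | const q => exact ⟨1, le_rfl, .const q v⟩
  | fst => exact ⟨1, le_rfl, .fst v⟩
  | snd => exact ⟨1, le_rfl, .snd v⟩
  | isPair => exact ⟨1, le_rfl, .isPair v⟩
  | add => exact ⟨1, le_rfl, .add v⟩
  | sub => exact ⟨1, le_rfl, .sub v⟩
  | mul => exact ⟨1, le_rfl, .mul v⟩
  | div => exact ⟨1, le_rfl, .div v⟩
  | less => exact ⟨1, le_rfl, .less v⟩

theorem runsIn_of_eval {p : Prog} {v r : Val} {T : ℕ} (hp : p.loopFree = true)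
    (hr : p.eval v = r) (hT : p.cost ≤ T) : RunsIn p v r T :=
  hr ▸ (p.runsIn_eval hp v).mono hT

/-- The `k`-th tail of a nested pair. -/
def tail : ℕ → Prog
  | 0 => .id
  | k + 1 => .seq .snd (tail k)

/-- The `k`-th component of a nested pair. -/
def nth (k : ℕ) : Prog := .seq (tail k) .fst

/-- The sum of the results of two programs. -/
def plus (p q : Prog) : Prog := .seq (.pair p q) .add

/-- The difference of the results of two programs. -/
def minus (p q : Prog) : Prog := .seq (.pair p q) .sub

/-- The product of the results of two programs. -/
def times (p q : Prog) : Prog := .seq (.pair p q) .mul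

/-- The quotient of the results of two programs. -/
def quot (p q : Prog) : Prog := .seq (.pair p q) .div

/-- Compare the results of two programs. -/
def lt (p q : Prog) : Prog := .seq (.pair p q) .less

/-- Fold over a list: the input is `(env, list, acc)`, the input of the step is
`(env, element, acc)`, its output is the new `acc`. -/
def fold (step : Prog) : Prog :=
  .seq
    (.loop (nth 1)
      (.pair .fst (.pair (.seq (nth 1) .snd)
        (.seq (.pair .fst (.pair (.seq (nth 1) .fst) (tail 2))) step))))
    (tail 2)

end Prog

namespace Val

@[simp] theorem ofProp_eq_nil (P : Prop) : ofProp P = nil ↔ ¬ P := by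
  unfold ofProp
  split_ifs with h <;> simp [h]

theorem ofSeq_eq_map {α : Type*} {n : ℕ} (enc : α → Val) (f : Fin n → α) :
    ofSeq (fun j => enc (f j)) = ofList ((List.ofFn f).map enc) := by
  rw [ofSeq, List.map_ofFn]
  rfl

/-- A natural number as a value. -/
noncomputable def ofNat (m : ℕ) : Val := num (m : ℝ)

/-- A list of natural numbers as a value. -/
noncomputable def ofNats (l : List ℕ) : Val := ofList (l.map ofNat)

end Val

/-! ### Folds over lists. -/

namespace RunsIn

theorem fold_loop {step : Prog} {env : Val} {T : ℕ} (l : List Val) (Inv : ℕ → Val → Prop)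
    (h : ∀ k (hk : k < l.length) acc, Inv k acc →
      ∃ acc', RunsIn step (.pair env (.pair l[k] acc)) acc' T ∧ Inv (k + 1) acc')
    (acc : Val) (hacc : Inv 0 acc) :
    ∃ r, RunsIn (.loop (Prog.nth 1) (.pair .fst (.pair (.seq (Prog.nth 1) .snd)
        (.seq (.pair .fst (.pair (.seq (Prog.nth 1) .fst) (Prog.tail 2))) step))))
      (.pair env (.pair (.ofList l) acc)) (.pair env (.pair .nil r)) (l.length * (T + 40) + 10)
      ∧ Inv l.length r := by
  induction l generalizing Inv acc with
  | nil =>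
    refine ⟨acc, (loop_done (S := 5) ?_).mono (by simp), hacc⟩
    exact Prog.runsIn_of_eval rfl rfl (by decide)
  | cons a l ih =>
    obtain ⟨acc', hs, hI⟩ := h 0 (by simp) acc hacc
    obtain ⟨r, hr, hI'⟩ := ih (fun k => Inv (k + 1))
      (fun k hk acc hk' => h (k + 1) (by simpa using hk) acc hk') acc' hI
    refine ⟨r, (loop_step (S := 5) (a := .ofList (a :: l)) (T := T + 34) (b := .pair env (.pair (.ofList l) acc'))
      ?_ ?_ ?_ hr).mono ?_, hI'⟩
    · exact Prog.runsIn_of_eval rfl rfl (by decide)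
    · simp [Val.ofList]
    · have h1 : RunsIn .fst (.pair env (.pair (.ofList (a :: l)) acc)) env 1 :=
        Prog.runsIn_of_eval rfl rfl (by decide)
      have h2 : RunsIn (.seq (Prog.nth 1) .snd) (.pair env (.pair (.ofList (a :: l)) acc))
        (.ofList l) 7 := Prog.runsIn_of_eval rfl rfl (by decide)
      have h3 : RunsIn (.pair .fst (.pair (.seq (Prog.nth 1) .fst) (Prog.tail 2)))
        (.pair env (.pair (.ofList (a :: l)) acc)) (.pair env (.pair a acc)) 16 :=
        Prog.runsIn_of_eval rfl rfl (by decide)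
      exact (h1.pair (h2.pair (h3.seq hs))).mono (by omega)
    · simp only [List.length_cons]
      nlinarith

/-- Folding with an invariant. -/
theorem fold {step : Prog} {env : Val} {T : ℕ} (l : List Val) (Inv : ℕ → Val → Prop)
    (h : ∀ k (hk : k < l.length) acc, Inv k acc →
      ∃ acc', RunsIn step (.pair env (.pair l[k] acc)) acc' T ∧ Inv (k + 1) acc')
    (acc : Val) (hacc : Inv 0 acc) :
    ∃ r, RunsIn (Prog.fold step) (.pair env (.pair (.ofList l) acc)) r (l.length * (T + 40) + 20)
      ∧ Inv l.length r := by
  obtain ⟨r, hr, hI⟩ := fold_loop l Inv h acc hacc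
  have h' : RunsIn (Prog.tail 2) (.pair env (.pair .nil r)) r 5 :=
    Prog.runsIn_of_eval rfl rfl (by decide)
  exact ⟨r, (hr.seq h').mono (by omega), hI⟩

/-- Folding with a function on encoded data. -/
theorem foldl {α β : Type*} {encA : α → Val} {encB : β → Val} {f : β → α → β} {step : Prog}
    {env : Val} {T : ℕ} (l : List α)
    (h : ∀ a ∈ l, ∀ b, RunsIn step (.pair env (.pair (encA a) (encB b))) (encB (f b a)) T) (b : β) :
    RunsIn (Prog.fold step) (.pair env (.pair (.ofList (l.map encA)) (encB b)))
      (encB (l.foldl f b)) (l.length * (T + 40) + 20) := by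
  obtain ⟨r, hr, hI⟩ := fold (step := step) (env := env) (T := T) (l.map encA)
    (fun k acc => acc = encB ((l.take k).foldl f b)) (by
      rintro k hk _ rfl
      rw [List.length_map] at hk
      refine ⟨_, ?_, rfl⟩
      rw [List.take_succ_eq_append_getElem hk, List.foldl_append, List.getElem_map]
      exact h _ (List.getElem_mem hk) _) (encB b) (by simp)
  simp only [List.length_map, List.take_length] at hr hI
  exact hI ▸ hr

end RunsIn

/-! ### A multiplicatively generated net of the unit disc -/

/-- The generator `1 / (1 - δ * I)` of a spiral in the unit disc. -/
noncomputable def spiral (δ : ℝ) : ℂ := ⟨1 / (1 + δ ^ 2), δ / (1 + δ ^ 2)⟩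

/-- The number `1 - δ * I` has modulus `√(1 + δ ^ 2)` and argument `-arctan δ`. The polar form
serves the analysis only; programs use the rational coordinates. -/
theorem spiral_eq_exp (δ : ℝ) :
    spiral δ = Complex.exp ((-(Real.log (1 + δ ^ 2) / 2) : ℝ) + (Real.arctan δ : ℝ) * Complex.I) := by
  have h1 : (0 : ℝ) < 1 + δ ^ 2 := by positivity
  have h2 : Real.exp (-(Real.log (1 + δ ^ 2) / 2)) = 1 / √(1 + δ ^ 2) := by
    rw [Real.exp_neg, one_div, ← Real.log_sqrt h1.le, Real.exp_log (Real.sqrt_pos.2 h1)]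
  have h3 : √(1 + δ ^ 2) * √(1 + δ ^ 2) = 1 + δ ^ 2 := Real.mul_self_sqrt h1.le
  rw [Complex.exp_add_mul_I, ← Complex.ofReal_exp, ← Complex.ofReal_cos, ← Complex.ofReal_sin, h2,
    Real.cos_arctan, Real.sin_arctan]
  have hs : 0 < √(1 + δ ^ 2) := Real.sqrt_pos.2 h1
  generalize √(1 + δ ^ 2) = s at hs h3 ⊢
  rw [spiral, ← h3]
  apply Complex.ext
  · simp only [Complex.mul_re, Complex.add_re, Complex.ofReal_re, Complex.ofReal_im, Complex.I_re,
      Complex.I_im]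
    field_simp
    ring
  · simp only [Complex.mul_im, Complex.add_im, Complex.add_re, Complex.mul_re, Complex.ofReal_re,
      Complex.ofReal_im, Complex.I_re, Complex.I_im]
    field_simp
    ring

theorem norm_spiral_pow_le (δ : ℝ) (m : ℕ) : ‖spiral δ ^ m‖ ≤ 1 := by
  rw [norm_pow]
  refine pow_le_one₀ (norm_nonneg _) ?_
  rw [spiral_eq_exp, Complex.norm_exp]
  simp only [Complex.add_re, Complex.ofReal_re, Complex.mul_re, Complex.I_re, Complex.ofReal_im,
    Complex.I_im, mul_zero, zero_mul, sub_zero, add_zero]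
  rw [Real.exp_le_one_iff]
  have : 0 ≤ Real.log (1 + δ ^ 2) := Real.log_nonneg (by nlinarith [sq_nonneg δ])
  linarith

theorem arctan_bounds {δ : ℝ} (h0 : 0 < δ) (h1 : δ ≤ 1) :
    δ / 2 ≤ Real.arctan δ ∧ Real.arctan δ ≤ δ := by
  have hpos : 0 < Real.arctan δ := Real.arctan_pos.2 h0
  constructor
  · have h : Real.sin (Real.arctan δ) ≤ Real.arctan δ := Real.sin_le hpos.le
    rw [Real.sin_arctan] at h
    refine le_trans ?_ h
    gcongr
    rw [Real.sqrt_le_left (by norm_num)]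
    nlinarith
  · have := Real.le_tan hpos.le (Real.arctan_lt_pi_div_two δ)
    rwa [Real.tan_arctan] at this

/-- Change the modulus first and then the angle: the real exponential is 1-Lipschitz on nonpositive
numbers, and a chord is no longer than its arc. -/
theorem norm_exp_sub_exp_le {x x' y y' : ℝ} (hx : x ≤ x') (hx' : x' ≤ 0) :
    ‖Complex.exp ((x : ℝ) + (y : ℝ) * Complex.I) - Complex.exp ((x' : ℝ) + (y' : ℝ) * Complex.I)‖
      ≤ (x' - x) + |y - y'| := by
  have e1 : Complex.exp ((x : ℝ) + (y : ℝ) * Complex.I)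
      - Complex.exp ((x' : ℝ) + (y' : ℝ) * Complex.I)
      = ((Real.exp x - Real.exp x' : ℝ) : ℂ) * Complex.exp ((y : ℝ) * Complex.I)
        + (Real.exp x' : ℝ) * (Complex.exp ((y' : ℝ) * Complex.I)
          * (Complex.exp (Complex.I * ((y - y' : ℝ) : ℂ)) - 1)) := by
    have : Complex.exp ((y : ℝ) * Complex.I) =
        Complex.exp ((y' : ℝ) * Complex.I) * Complex.exp (Complex.I * ((y - y' : ℝ) : ℂ)) := by
      rw [← Complex.exp_add]
      congr 1
      push_cast
      ring
    rw [Complex.exp_add, Complex.exp_add, this]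
    push_cast
    ring
  rw [e1]
  refine (norm_add_le _ _).trans ?_
  simp only [norm_mul, Complex.norm_exp_ofReal_mul_I, Complex.norm_real, mul_one, one_mul]
  have hE : Real.exp x' ≤ 1 := Real.exp_le_one_iff.2 hx'
  have hx2 : Real.exp x ≤ Real.exp x' := Real.exp_le_exp.2 hx
  have h3 : Real.exp x' - Real.exp x ≤ x' - x := by
    have h4 : x - x' + 1 ≤ Real.exp (x - x') := Real.add_one_le_exp _
    have h5 : Real.exp x = Real.exp x' * Real.exp (x - x') := by
      rw [← Real.exp_add]; congr 1; ring
    have := Real.exp_pos x'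
    rw [h5]
    nlinarith
  rw [Real.norm_eq_abs, Real.norm_eq_abs, abs_of_pos (Real.exp_pos x'),
    abs_of_nonpos (sub_nonpos.2 hx2)]
  have h6 := Real.norm_exp_I_mul_ofReal_sub_one_le (x := y - y')
  rw [Real.norm_eq_abs] at h6
  have := norm_nonneg (Complex.exp (Complex.I * ((y - y' : ℝ) : ℂ)) - 1)
  nlinarith [Real.exp_pos x']

/-- Follow the spiral until its modulus has dropped to that of `z`, then for at most about one more
turn until the angle fits. During that turn the modulus changes only by `O(δ)`. -/
theorem exists_spiral_pow_near {δ : ℝ} (h0 : 0 < δ) (h1 : δ ≤ 1) {z : ℂ} (hz : ‖z‖ ≤ 1) :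
    ∃ m : ℕ, (m : ℝ) ≤ 18 / δ ^ 3 ∧ ‖spiral δ ^ m - z‖ ≤ 10 * δ := by
  set a := Real.arctan δ with ha
  set lam := Real.log (1 + δ ^ 2) / 2 with hlam
  obtain ⟨ha1, ha2⟩ := arctan_bounds h0 h1
  have ha0 : 0 < a := by linarith
  have hl1 : δ ^ 2 / 4 ≤ lam := by
    have h := Real.one_sub_inv_le_log_of_pos (x := 1 + δ ^ 2) (by positivity)
    have h' : δ ^ 2 / 2 ≤ 1 - (1 + δ ^ 2)⁻¹ := by
      rw [← sub_nonneg]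
      have : 1 - (1 + δ ^ 2)⁻¹ - δ ^ 2 / 2 = δ ^ 2 * (1 - δ ^ 2) / (2 * (1 + δ ^ 2)) := by
        field_simp
        ring
      rw [this]
      have : δ ^ 2 ≤ 1 := by nlinarith
      have : 0 ≤ 1 - δ ^ 2 := by linarith
      positivity
    linarith
  have hl2 : lam ≤ δ ^ 2 / 2 := by
    have := Real.log_le_sub_one_of_pos (x := 1 + δ ^ 2) (by positivity)
    linarith
  have hl0 : 0 < lam := by nlinarith [pow_pos h0 2]
  -- Points near the origin are moved to modulus `δ`. This costs an error of `δ` and keeps the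
  -- logarithm, hence the number of powers, bounded.
  set ρ := max ‖z‖ δ with hρ
  have hρδ : δ ≤ ρ := le_max_right _ _
  have hρ0 : 0 < ρ := h0.trans_le hρδ
  have hρ1 : ρ ≤ 1 := max_le hz h1
  set ψ := Complex.arg z
  -- The real exponent at which the spiral has modulus exactly `ρ`.
  set t := -Real.log ρ / lam with ht
  have ht0 : 0 ≤ t := div_nonneg (neg_nonneg.2 (Real.log_nonpos hρ0.le hρ1)) hl0.le
  have htl : lam * t = -Real.log ρ := by rw [ht]; field_simp
  have ht1 : t ≤ 4 / δ ^ 3 := by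
    have h2 : -Real.log ρ ≤ 1 / δ := by
      rw [← Real.log_inv]
      have := Real.log_le_sub_one_of_pos (inv_pos.2 hρ0)
      have h3 : ρ⁻¹ ≤ δ⁻¹ := inv_anti₀ h0 hρδ
      rw [one_div]
      linarith
    calc t ≤ (1 / δ) / (δ ^ 2 / 4) := by rw [ht]; gcongr
      _ = 4 / δ ^ 3 := by field_simp
  have hpi := Real.pi_pos
  -- Lifts the argument of `z` to the first representative `y` not below the angle `t * a` reached
  -- at exponent `t`; `y` exceeds it by at most one turn.
  set j := ⌈(t * a - ψ) / (2 * Real.pi)⌉ with hj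
  set y := ψ + 2 * Real.pi * j with hy
  have hy1 : t * a ≤ y := by
    have := Int.le_ceil ((t * a - ψ) / (2 * Real.pi))
    rw [div_le_iff₀ (by positivity)] at this
    rw [hy]; linarith
  have hy2 : y ≤ t * a + 2 * Real.pi := by
    have := (Int.ceil_lt_add_one ((t * a - ψ) / (2 * Real.pi))).le
    rw [← sub_le_iff_le_add, le_div_iff₀ (by positivity)] at this
    rw [hy]; linarith
  have hya : t ≤ y / a := by rwa [le_div_iff₀ ha0]
  set m := ⌈y / a⌉₊ with hm
  have hm1 : y / a ≤ m := Nat.le_ceil _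
  have hm2 : (m : ℝ) < y / a + 1 := Nat.ceil_lt_add_one (ht0.trans hya)
  have hm3 : (m : ℝ) ≤ t + 13 / δ + 1 := by
    have : y / a ≤ t + 13 / δ := by
      have e : 2 * Real.pi / a ≤ 13 / δ := by
        rw [div_le_div_iff₀ ha0 h0]
        have := Real.pi_lt_d2
        nlinarith
      calc y / a ≤ (t * a + 2 * Real.pi) / a := by gcongr
        _ = t + 2 * Real.pi / a := by field_simp
        _ ≤ _ := by linarith
    linarith
  refine ⟨m, ?_, ?_⟩
  · have h3 : 13 / δ ≤ 13 / δ ^ 3 := by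
      gcongr
      nlinarith [pow_pos h0 2, pow_pos h0 3]
    have h4 : 1 ≤ 1 / δ ^ 3 := by
      rw [le_div_iff₀ (by positivity), one_mul]
      exact pow_le_one₀ h0.le h1
    have : 18 / δ ^ 3 = 4 / δ ^ 3 + 13 / δ ^ 3 + 1 / δ ^ 3 := by ring
    linarith
  · have hz' : ‖(ρ : ℂ) * Complex.exp (ψ * Complex.I) - z‖ ≤ δ := by
      conv_lhs => rw [← Complex.norm_mul_exp_arg_mul_I z]
      rw [← sub_mul, norm_mul, Complex.norm_exp_ofReal_mul_I, mul_one, ← Complex.ofReal_sub,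
        Complex.norm_real, Real.norm_eq_abs, abs_le]
      rcases max_cases ‖z‖ δ with h | h <;> constructor <;> linarith [norm_nonneg z, h.1, h.2]
    have e1 : spiral δ ^ m = Complex.exp (((-(lam * m) : ℝ) : ℂ) + ((m * a : ℝ) : ℂ) * Complex.I) := by
      rw [spiral_eq_exp, ← hlam, ← ha, ← Complex.exp_nat_mul]
      congr 1
      push_cast
      ring
    have e2 : (ρ : ℂ) * Complex.exp (ψ * Complex.I)
        = Complex.exp (((-(lam * t) : ℝ) : ℂ) + ((y : ℝ) : ℂ) * Complex.I) := by
      rw [Complex.exp_add, htl, neg_neg, ← Complex.ofReal_exp, Real.exp_log hρ0]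
      congr 1
      rw [Complex.exp_eq_exp_iff_exists_int]
      refine ⟨-j, ?_⟩
      rw [hy]
      push_cast
      ring
    have hmt : t ≤ m := hya.trans hm1
    have h5 : ‖spiral δ ^ m - (ρ : ℂ) * Complex.exp (ψ * Complex.I)‖
        ≤ (-(lam * t) - -(lam * m)) + |m * a - y| := by
      rw [e1, e2]
      exact norm_exp_sub_exp_le (by nlinarith) (by nlinarith)
    have h6 : |m * a - y| ≤ δ := by
      have h7 : y ≤ m * a := by rwa [div_le_iff₀ ha0] at hm1
      have h8 : m * a ≤ y + a := by
        have : y / a * a = y := by field_simp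
        nlinarith
      rw [abs_of_nonneg (by linarith)]
      linarith
    -- The extra turn takes at most `14 / δ` steps, each lowering the logarithm of the modulus by at
    -- most `δ ^ 2 / 2`.
    have h9 : -(lam * t) - -(lam * m) ≤ 7 * δ := by
      have h10 : (m : ℝ) - t ≤ 14 / δ := by
        have : 14 / δ = 13 / δ + 1 / δ := by ring
        have : 1 ≤ 1 / δ := by rw [le_div_iff₀ h0]; linarith
        linarith
      calc -(lam * t) - -(lam * m) = lam * (m - t) := by ring
        _ ≤ (δ ^ 2 / 2) * (14 / δ) := by
          apply mul_le_mul hl2 h10 (by linarith) (by positivity)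
        _ = 7 * δ := by field_simp; norm_num
    calc ‖spiral δ ^ m - z‖ ≤ _ := norm_sub_le_norm_sub_add_norm_sub _ ((ρ : ℂ) * Complex.exp (ψ * Complex.I)) _
      _ ≤ 10 * δ := by linarith

/-- The first power of the spiral generator that is close to `z`. -/
noncomputable def spiralIndex (δ : ℝ) (z : ℂ) : ℕ := sInf {m | ‖spiral δ ^ m - z‖ ≤ 10 * δ}

theorem spiralIndex_spec {δ : ℝ} (h0 : 0 < δ) (h1 : δ ≤ 1) {z : ℂ} (hz : ‖z‖ ≤ 1) :
    ‖spiral δ ^ spiralIndex δ z - z‖ ≤ 10 * δ ∧ (spiralIndex δ z : ℝ) ≤ 18 / δ ^ 3 := by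
  obtain ⟨m, hm, hm'⟩ := exists_spiral_pow_near h0 h1 hz
  refine ⟨Nat.sInf_mem (s := {m | ‖spiral δ ^ m - z‖ ≤ 10 * δ}) ⟨m, hm'⟩, le_trans ?_ hm⟩
  exact_mod_cast Nat.sInf_le (s := {m | ‖spiral δ ^ m - z‖ ≤ 10 * δ}) hm'

/-- Minimality of the index; it keeps the search loop running until exactly this index. -/
theorem lt_norm_of_lt_spiralIndex {δ : ℝ} {z : ℂ} {m : ℕ} (hm : m < spiralIndex δ z) :
    10 * δ < ‖spiral δ ^ m - z‖ :=
  not_le.1 (Nat.notMem_of_lt_sInf hm)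

/-! ### Products of numbers in the unit disc -/

theorem norm_prod_le_one {ι : Type*} (s : Finset ι) (x : ι → ℂ) (hx : ∀ e ∈ s, ‖x e‖ ≤ 1) :
    ‖∏ e ∈ s, x e‖ ≤ 1 := by
  rw [norm_prod]
  exact Finset.prod_le_one (fun _ _ => norm_nonneg _) hx

/-- Exchange one factor at a time: the other factors have modulus at most one, so each exchange
costs at most `η`. -/
theorem norm_prod_sub_prod_le {ι : Type*} (s : Finset ι) (x y : ι → ℂ) (η : ℝ)
    (hx : ∀ e ∈ s, ‖x e‖ ≤ 1) (hy : ∀ e ∈ s, ‖y e‖ ≤ 1) (h : ∀ e ∈ s, ‖x e - y e‖ ≤ η) :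
    ‖∏ e ∈ s, x e - ∏ e ∈ s, y e‖ ≤ s.card * η := by
  classical
  induction s using Finset.induction_on with
  | empty => simp
  | insert a s ha ih =>
    rw [Finset.prod_insert ha, Finset.prod_insert ha, Finset.card_insert_of_notMem ha]
    have e : x a * ∏ e ∈ s, x e - y a * ∏ e ∈ s, y e
        = x a * (∏ e ∈ s, x e - ∏ e ∈ s, y e) + (x a - y a) * ∏ e ∈ s, y e := by ring
    rw [e]
    have i := ih (fun e he => hx e (Finset.mem_insert_of_mem he))
      (fun e he => hy e (Finset.mem_insert_of_mem he)) fun e he => h e (Finset.mem_insert_of_mem he)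
    have p := norm_prod_le_one s y fun e he => hy e (Finset.mem_insert_of_mem he)
    have xa := hx a (Finset.mem_insert_self _ _)
    have ha' := h a (Finset.mem_insert_self _ _)
    refine (norm_add_le _ _).trans ?_
    rw [norm_mul, norm_mul]
    have b1 : ‖x a‖ * ‖∏ e ∈ s, x e - ∏ e ∈ s, y e‖ ≤ 1 * (s.card * η) :=
      mul_le_mul xa i (norm_nonneg _) zero_le_one
    have b2 : ‖x a - y a‖ * ‖∏ e ∈ s, y e‖ ≤ η * 1 :=
      mul_le_mul ha' p (norm_nonneg _) ((norm_nonneg _).trans ha')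
    push_cast
    linarith

/-- The value of the solution `S` in terms of the expectations `α e k`. -/
noncomputable def solutionValue {n L : ℕ} (c : Fin L → ℂ) (α : Fin n → Fin L → ℂ)
    (S : Finset (Fin n)) : ℂ := ∑ k, c k * ∏ e ∈ S, α e k

/-- For each `k`, both products are within `10 * n * δ` of the same power of `spiral δ`, because the
exponent sums agree. -/
theorem norm_solutionValue_sub_le {n L : ℕ} (c : Fin L → ℂ) (α : Fin n → Fin L → ℂ) {δ : ℝ}
    (h0 : 0 < δ) (h1 : δ ≤ 1) (hα : ∀ e k, ‖α e k‖ ≤ 1) (S T : Finset (Fin n))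
    (h : ∀ k, ∑ e ∈ S, spiralIndex δ (α e k) = ∑ e ∈ T, spiralIndex δ (α e k)) :
    ‖solutionValue c α S - solutionValue c α T‖ ≤ (∑ k, ‖c k‖) * (20 * n * δ) := by
  rw [solutionValue, solutionValue, ← Finset.sum_sub_distrib, Finset.sum_mul]
  refine (norm_sum_le _ _).trans (Finset.sum_le_sum fun k _ => ?_)
  rw [← mul_sub, norm_mul]
  refine mul_le_mul_of_nonneg_left ?_ (norm_nonneg _)
  have key : ∀ U : Finset (Fin n),
      ‖∏ e ∈ U, spiral δ ^ spiralIndex δ (α e k) - ∏ e ∈ U, α e k‖ ≤ n * (10 * δ) := by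
    intro U
    refine (norm_prod_sub_prod_le U _ _ (10 * δ) (fun e _ => norm_spiral_pow_le _ _)
      (fun e _ => hα e k) fun e _ => (spiralIndex_spec h0 h1 (hα e k)).1).trans ?_
    gcongr
    simpa using Finset.card_le_univ U
  have hS := key S
  have hT := key T
  rw [Finset.prod_pow_eq_pow_sum] at hS hT
  rw [← h k] at hT
  rw [norm_sub_rev] at hS
  have := norm_sub_le_norm_sub_add_norm_sub (∏ e ∈ S, α e k)
    (spiral δ ^ ∑ e ∈ S, spiralIndex δ (α e k)) (∏ e ∈ T, α e k)
  linarith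

/-! ### Packing several numbers into one -/

theorem ofDigits_ofFn_eq_sum (B : ℕ) {L : ℕ} (f : Fin L → ℕ) :
    Nat.ofDigits B (List.ofFn f) = ∑ k, f k * B ^ (k : ℕ) := by
  induction L with
  | zero => simp
  | succ L ih =>
    rw [List.ofFn_succ, Nat.ofDigits_cons, ih, Fin.sum_univ_succ, Finset.mul_sum]
    simp only [Fin.val_zero, pow_zero, mul_one, Fin.val_succ]
    congr 1
    exact Finset.sum_congr rfl fun k _ => by ring

/-- The base exceeds each digit's total over all elements, so adding packed numbers never carries
and digits of equal sums can be compared. -/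
theorem sum_digit_eq_of_sum_ofDigits_eq {n L : ℕ} {B : ℕ} (hB : 1 < B) (m : Fin n → Fin L → ℕ)
    (hm : ∀ k, ∑ e, m e k < B) (S T : Finset (Fin n))
    (h : ∑ e ∈ S, Nat.ofDigits B (List.ofFn (m e)) = ∑ e ∈ T, Nat.ofDigits B (List.ofFn (m e)))
    (k : Fin L) : ∑ e ∈ S, m e k = ∑ e ∈ T, m e k := by
  have key : ∀ U : Finset (Fin n), ∑ e ∈ U, Nat.ofDigits B (List.ofFn (m e))
      = Nat.ofDigits B (List.ofFn fun k => ∑ e ∈ U, m e k) := by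
    intro U
    simp only [ofDigits_ofFn_eq_sum, Finset.sum_mul]
    exact Finset.sum_comm
  have lt : ∀ U : Finset (Fin n), ∀ l ∈ List.ofFn (fun k => ∑ e ∈ U, m e k), l < B := by
    intro U l hl
    rw [List.mem_ofFn] at hl
    obtain ⟨k, rfl⟩ := hl
    exact (Finset.sum_le_univ_sum_of_nonneg fun _ => Nat.zero_le _).trans_lt (hm k)
  rw [key, key] at h
  have := Nat.ofDigits_inj_of_len_eq hB (by simp) (lt S) (lt T) h
  exact congrFun (List.ofFn_injective this) k

/-! ### Expected utility of independent weights -/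

theorem measurable_powArg (φ : ℂ) (θ : ℝ) : Measurable (powArg φ θ) := by
  unfold powArg
  fun_prop

theorem norm_powArg_le_one {φ : ℂ} (hφ : ‖φ‖ ≤ 1) (θ : ℝ) {x : ℝ} (hx : 0 ≤ x) :
    ‖powArg φ θ x‖ ≤ 1 := by
  rw [powArg, norm_mul, Complex.norm_exp_ofReal_mul_I, mul_one, Complex.norm_real,
    Real.norm_eq_abs, abs_of_nonneg (Real.rpow_nonneg (norm_nonneg _) _)]
  exact Real.rpow_le_one (norm_nonneg _) hφ hx

theorem powArg_zero (φ : ℂ) (θ : ℝ) : powArg φ θ 0 = 1 := by simp [powArg]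

/-- Nonnegative exponents make the law valid for `φ = 0` as well, with `0 ^ 0 = 1`. -/
theorem powArg_add (φ : ℂ) (θ : ℝ) {x y : ℝ} (hx : 0 ≤ x) (hy : 0 ≤ y) :
    powArg φ θ (x + y) = powArg φ θ x * powArg φ θ y := by
  rw [powArg, powArg, powArg, Real.rpow_add_of_nonneg (norm_nonneg _) hx hy, mul_mul_mul_comm,
    ← Complex.exp_add]
  push_cast
  ring_nf

theorem powArg_sum (φ : ℂ) (θ : ℝ) {ι : Type*} (s : Finset ι) (x : ι → ℝ)
    (hx : ∀ e ∈ s, 0 ≤ x e) : powArg φ θ (∑ e ∈ s, x e) = ∏ e ∈ s, powArg φ θ (x e) := by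
  classical
  induction s using Finset.induction_on with
  | empty => simp [powArg_zero]
  | insert a s ha ih =>
    have h' : ∀ e ∈ s, 0 ≤ x e := fun e he => hx e (Finset.mem_insert_of_mem he)
    rw [Finset.sum_insert ha, Finset.prod_insert ha,
      powArg_add _ _ (hx a (Finset.mem_insert_self _ _)) (Finset.sum_nonneg h'), ih h']

section Expectation

variable {Ω : Type v} [MeasurableSpace Ω] {P : Measure Ω} [IsProbabilityMeasure P] {n : ℕ}
  {w : Fin n → Ω → ℝ}

theorem norm_integral_powArg_le_one {φ : ℂ} (hφ : ‖φ‖ ≤ 1) (θ : ℝ) {X : Ω → ℝ}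
    (hX : ∀ᵐ ω ∂P, 0 ≤ X ω) : ‖∫ ω, powArg φ θ (X ω) ∂P‖ ≤ 1 := by
  have := norm_integral_le_of_norm_le_const (μ := P) (f := fun ω => powArg φ θ (X ω)) (C := 1)
    (by filter_upwards [hX] with ω hω using norm_powArg_le_one hφ θ hω)
  simpa using this

theorem integral_powArg_sum (hw : ∀ e, Measurable (w e)) (hw0 : ∀ e, ∀ᵐ ω ∂P, 0 ≤ w e ω)
    (hind : iIndepFun w P) (φ : ℂ) (θ : ℝ) (S : Finset (Fin n)) :
    ∫ ω, powArg φ θ (∑ e ∈ S, w e ω) ∂P = ∏ e ∈ S, ∫ ω, powArg φ θ (w e ω) ∂P := by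
  classical
  -- Elements outside `S` receive the constant factor 1, so that independence of the whole family
  -- applies to a product over all elements.
  have h1 : ∫ ω, powArg φ θ (∑ e ∈ S, w e ω) ∂P
      = ∫ ω, ∏ e, (fun x => if e ∈ S then powArg φ θ x else 1) (w e ω) ∂P := by
    refine integral_congr_ae ?_
    filter_upwards [ae_all_iff.2 hw0] with ω hω
    rw [powArg_sum _ _ _ _ fun e _ => hω e]
    simp
  rw [h1, hind.integral_fun_prod_comp (f := fun e x => if e ∈ S then powArg φ θ x else 1)
    fun e => (hw e).aemeasurable]
  · rw [← Finset.prod_subset (Finset.subset_univ S)]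
    · exact Finset.prod_congr rfl fun e he => by simp [he]
    · intro e _ he
      simp [he]
  · intro e
    by_cases he : e ∈ S
    · simpa [he] using (measurable_powArg φ θ).aestronglyMeasurable
    · simpa [he] using aestronglyMeasurable_const

theorem expectedUtility_expSum (hw : ∀ e, Measurable (w e)) (hw0 : ∀ e, ∀ᵐ ω ∂P, 0 ≤ w e ω)
    (hind : iIndepFun w P) {L : ℕ} (c φ : Fin L → ℂ) (θ : Fin L → ℝ) (hφ : ∀ k, ‖φ k‖ ≤ 1)
    (S : Finset (Fin n)) :
    expectedUtility P w (expSum c φ θ) S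
      = solutionValue c (fun e k => ∫ ω, powArg (φ k) (θ k) (w e ω) ∂P) S := by
  unfold expectedUtility expSum solutionValue
  rw [integral_finsetSum]
  · refine Finset.sum_congr rfl fun k _ => ?_
    rw [integral_const_mul, integral_powArg_sum hw hw0 hind]
  · intro k _
    refine Integrable.const_mul ?_ _
    refine Integrable.of_bound ((measurable_powArg _ _).comp
      (Finset.measurable_sum _ fun e _ => hw e)).aestronglyMeasurable 1 ?_
    filter_upwards [ae_all_iff.2 hw0] with ω hω
    exact norm_powArg_le_one (hφ k) _ (Finset.sum_nonneg fun e _ => hω e)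

end Expectation

/-! ### Elementary programs -/

attribute [simp] Prog.eval Prog.nth Prog.tail Prog.plus Prog.minus Prog.times Prog.quot Prog.lt
  Val.fst Val.snd Val.arith Val.less

namespace Prog

/-- The product of two complex numbers. -/
def cmul (p q : Prog) : Prog :=
  .pair (minus (times (.seq p .fst) (.seq q .fst)) (times (.seq p .snd) (.seq q .snd)))
    (plus (times (.seq p .fst) (.seq q .snd)) (times (.seq p .snd) (.seq q .fst)))

/-- The sum of two complex numbers. -/
def cadd (p q : Prog) : Prog :=
  .pair (plus (.seq p .fst) (.seq q .fst)) (plus (.seq p .snd) (.seq q .snd))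

/-- The squared absolute value of a complex number. -/
def cnormSq (p : Prog) : Prog :=
  plus (times (.seq p .fst) (.seq p .fst)) (times (.seq p .snd) (.seq p .snd))

theorem eval_cadd {p q : Prog} {v : Val} {x y : ℂ} (hp : p.eval v = .ofComplex x)
    (hq : q.eval v = .ofComplex y) : (cadd p q).eval v = .ofComplex (x + y) := by
  simp [cadd, hp, hq, Val.ofComplex]

theorem eval_cnormSq {p : Prog} {v : Val} {x : ℂ} (hp : p.eval v = .ofComplex x) :
    (cnormSq p).eval v = .num (x.re * x.re + x.im * x.im) := by
  simp [cnormSq, hp, Val.ofComplex]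

theorem runsIn_reverseAppend (env : Val) (l l' : List Val) :
    RunsIn (fold .snd) (.pair env (.pair (.ofList l) (.ofList l'))) (.ofList (l.reverse ++ l'))
      (l.length * 41 + 20) := by
  have h := RunsIn.foldl (step := .snd) (env := env) (T := 1) (encA := fun a : Val => a)
    (encB := Val.ofList) (f := fun acc a => a :: acc) l
    (fun a _ b => runsIn_of_eval rfl rfl le_rfl) l'
  simpa [List.foldl_flip_cons_eq_append] using h

/-! ### The step size -/

/-- From the list of the coefficients to the number `1 + ∑ (1 + |c k| ^ 2)`. -/
def coeffBound : Prog :=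
  .seq (.pair .nil (.pair .id (.const 1)))
    (fold (plus (tail 2) (plus (.const 1) (cnormSq (nth 1)))))

/-- The length of a list plus one. -/
def lengthSucc : Prog :=
  .seq (.pair .nil (.pair .id (.const 1))) (fold (plus (tail 2) (.const 1)))

/-- From `(descr, ε, coefficients, rows)` to the step size. -/
def stepSize : Prog :=
  quot (nth 1) (plus (nth 1)
    (times (times (.const 40) (.seq (tail 3) lengthSucc)) (.seq (nth 2) coeffBound)))

end Prog

/-- An upper bound for the sum of the absolute values of the coefficients. -/
noncomputable def coeffBound {L : ℕ} (c : Fin L → ℂ) : ℝ :=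
  1 + ∑ k, (1 + ((c k).re * (c k).re + (c k).im * (c k).im))

/-- The step size of the spiral. -/
noncomputable def stepSize {L : ℕ} (c : Fin L → ℂ) (n : ℕ) (ε : ℝ) : ℝ :=
  ε / (ε + 40 * (n + 1) * coeffBound c)

theorem foldl_add_eq {α M : Type*} [AddMonoid M] (g : α → M) (l : List α) (x : M) :
    l.foldl (fun acc a => acc + g a) x = x + (l.map g).sum := by
  induction l generalizing x with
  | nil => simp
  | cons a l ih => simp [ih, add_assoc]

namespace Prog

theorem runsIn_coeffBound {L : ℕ} (c : Fin L → ℂ) :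
    RunsIn coeffBound (.ofSeq fun k => .ofComplex (c k)) (.num (_root_.coeffBound c))
      (L * 100 + 30) := by
  have h := RunsIn.foldl (step := plus (tail 2) (plus (.const 1) (cnormSq (nth 1)))) (env := .nil)
    (T := 60) (encA := Val.ofComplex) (encB := Val.num)
    (f := fun acc a => acc + (1 + (a.re * a.re + a.im * a.im))) (List.ofFn c)
    (fun a _ b => runsIn_of_eval rfl (by simp [cnormSq, Val.ofComplex]) (by decide)) 1
  rw [foldl_add_eq, ← Val.ofSeq_eq_map, List.map_ofFn, List.sum_ofFn] at h
  have h0 : RunsIn (.pair .nil (.pair .id (.const 1))) (.ofSeq fun k => .ofComplex (c k))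
      (.pair .nil (.pair (.ofSeq fun k => .ofComplex (c k)) (.num 1))) 5 :=
    runsIn_of_eval rfl (by simp) (by decide)
  refine (h0.seq h).mono ?_
  simp only [List.length_ofFn]
  omega

theorem runsIn_lengthSucc {n : ℕ} (x : Fin n → Val) :
    RunsIn lengthSucc (.ofSeq x) (.num (n + 1)) (n * 60 + 30) := by
  have h := RunsIn.foldl (step := plus (tail 2) (.const 1)) (env := .nil)
    (T := 20) (encA := fun a : Val => a) (encB := Val.num)
    (f := fun acc _ => acc + 1) (List.ofFn x)
    (fun a _ b => runsIn_of_eval rfl (by simp) (by decide)) 1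
  rw [foldl_add_eq (fun _ => (1 : ℝ)), ← Val.ofSeq_eq_map, List.map_ofFn, List.sum_ofFn] at h
  have h0 : RunsIn (.pair .nil (.pair .id (.const 1))) (.ofSeq x)
      (.pair .nil (.pair (.ofSeq x) (.num 1))) 5 :=
    runsIn_of_eval rfl (by simp) (by decide)
  have h1 := (h0.seq h).mono (T := n * 60 + 30) (by simp only [List.length_ofFn]; omega)
  convert! h1 using 2
  simp [add_comm]

theorem runsIn_stepSize {L n : ℕ} (c : Fin L → ℂ) (x : Fin n → Val) (descr : Val) (ε : ℝ) :
    RunsIn stepSize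
      (.pair descr (.pair (.num ε) (.pair (.ofSeq fun k => .ofComplex (c k)) (.ofSeq x))))
      (.num (_root_.stepSize c n ε)) (L * 100 + n * 60 + 200) := by
  set v : Val := .pair descr (.pair (.num ε) (.pair (.ofSeq fun k => .ofComplex (c k)) (.ofSeq x)))
  have hε : RunsIn (nth 1) v (.num ε) 5 := runsIn_of_eval rfl rfl (by decide)
  have hc : RunsIn (nth 2) v (.ofSeq fun k => .ofComplex (c k)) 7 :=
    runsIn_of_eval rfl rfl (by decide)
  have hx : RunsIn (tail 3) v (.ofSeq x) 7 := runsIn_of_eval rfl rfl (by decide)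
  have h40 : RunsIn (.const 40) v (.num 40) 1 := runsIn_of_eval rfl (by simp) (by decide)
  have op : ∀ (o : Prog) (f : ℝ → ℝ → ℝ), (∀ v, RunsIn o v (v.arith f) 1) →
      ∀ {p q : Prog} {a b : ℝ} {S T : ℕ}, RunsIn p v (.num a) S → RunsIn q v (.num b) T →
      RunsIn (.seq (.pair p q) o) v (.num (f a b)) (S + T + 3) := by
    intro o f ho p q a b S T hp hq
    exact ((hp.pair hq).seq (ho _)).mono (by omega)
  have hadd := @op .add (fun x y => x + y) fun v => ⟨1, le_rfl, .add v⟩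
  have hmul := @op .mul (fun x y => x * y) fun v => ⟨1, le_rfl, .mul v⟩
  have hdiv := @op .div (fun x y => x / y) fun v => ⟨1, le_rfl, .div v⟩
  exact (hdiv hε (hadd hε (hmul (hmul h40 (hx.seq (runsIn_lengthSucc x)))
    (hc.seq (runsIn_coeffBound c))))).mono (by omega)

/-! ### The search for a close power of the spiral generator -/

/-- The test whether the current power is too far away; the state is `((δ, z), power, index)`. -/
def spiralTest : Prog :=
  lt (times (.const 100) (times (.seq .fst .fst) (.seq .fst .fst)))
    (plus
      (times (minus (.seq (nth 1) .fst) (.seq (.seq .fst .snd) .fst))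
        (minus (.seq (nth 1) .fst) (.seq (.seq .fst .snd) .fst)))
      (times (minus (.seq (nth 1) .snd) (.seq (.seq .fst .snd) .snd))
        (minus (.seq (nth 1) .snd) (.seq (.seq .fst .snd) .snd))))

/-- Proceed to the next power. -/
def spiralNext : Prog :=
  .pair .fst (.pair
    (.pair
      (quot (minus (.seq (nth 1) .fst) (times (.seq .fst .fst) (.seq (nth 1) .snd)))
        (plus (.const 1) (times (.seq .fst .fst) (.seq .fst .fst))))
      (quot (plus (.seq (nth 1) .snd) (times (.seq .fst .fst) (.seq (nth 1) .fst)))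
        (plus (.const 1) (times (.seq .fst .fst) (.seq .fst .fst)))))
    (plus (tail 2) (.const 1)))

/-- From `(δ, z)` to the first index of a power of the spiral generator close to `z`. -/
def spiralSearch : Prog :=
  .seq (.pair .id (.pair (.pair (.const 1) (.const 0)) (.const 0)))
    (.seq (.loop spiralTest spiralNext) (tail 2))

theorem runsIn_spiralSearch {δ : ℝ} (h0 : 0 < δ) (h1 : δ ≤ 1) {z : ℂ} (hz : ‖z‖ ≤ 1) {M : ℕ}
    (hM : spiralIndex δ z ≤ M) :
    RunsIn spiralSearch (.pair (.num δ) (.ofComplex z)) (.ofNat (spiralIndex δ z))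
      ((M + 1) * 300) := by
  have test : ∀ k : ℕ, RunsIn spiralTest
      (.pair (.pair (.num δ) (.ofComplex z)) (.pair (.ofComplex (spiral δ ^ k)) (.ofNat k)))
      (.ofProp (10 * δ < ‖spiral δ ^ k - z‖)) 100 := by
    intro k
    refine runsIn_of_eval rfl ?_ (by decide)
    -- Squared distances are compared because the machine has no square roots.
    have e : (10 * δ < ‖spiral δ ^ k - z‖) ↔ (100 * (δ * δ) <
        ((spiral δ ^ k).re - z.re) * ((spiral δ ^ k).re - z.re)
          + ((spiral δ ^ k).im - z.im) * ((spiral δ ^ k).im - z.im)) := by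
      rw [← sq_lt_sq₀ (by positivity) (norm_nonneg _), ← Complex.normSq_eq_norm_sq,
        Complex.normSq_apply, Complex.sub_re, Complex.sub_im]
      ring_nf
    rw [e]
    simp [spiralTest, Val.ofComplex]
  obtain ⟨r, hr, hI⟩ := RunsIn.loop (c := spiralTest) (p := spiralNext) (S := 100) (T := 120)
    (spiralIndex δ z)
    (fun k v => v = .pair (.pair (.num δ) (.ofComplex z))
      (.pair (.ofComplex (spiral δ ^ k)) (.ofNat k))) (by
      rintro k hk _ rfl
      refine ⟨⟨_, ?_, test k⟩, _, ?_, rfl⟩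
      · simpa using lt_norm_of_lt_spiralIndex hk
      · refine runsIn_of_eval rfl ?_ (by decide)
        -- Multiplication by `(1 + δ * I) / (1 + δ ^ 2)`, in coordinates.
        have e : spiral δ ^ (k + 1) = ⟨((spiral δ ^ k).re - δ * (spiral δ ^ k).im) / (1 + δ * δ),
            ((spiral δ ^ k).im + δ * (spiral δ ^ k).re) / (1 + δ * δ)⟩ := by
          rw [pow_succ]
          apply Complex.ext
          · simp only [Complex.mul_re, spiral]
            ring
          · simp only [Complex.mul_im, spiral]
            ring
        rw [e]
        simp [spiralNext, Val.ofComplex, Val.ofNat]) (by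
      rintro _ rfl
      have := test (spiralIndex δ z)
      rwa [(Val.ofProp_eq_nil _).2 (not_lt.2 (spiralIndex_spec h0 h1 hz).1)] at this)
    (.pair (.pair (.num δ) (.ofComplex z)) (.pair (.ofComplex (spiral δ ^ 0)) (.ofNat 0))) rfl
  subst hI
  have hs : RunsIn (.pair .id (.pair (.pair (.const 1) (.const 0)) (.const 0)))
      (.pair (.num δ) (.ofComplex z))
      (.pair (.pair (.num δ) (.ofComplex z)) (.pair (.ofComplex (spiral δ ^ 0)) (.ofNat 0))) 7 :=
    runsIn_of_eval rfl (by simp [Val.ofComplex, Val.ofNat]) (by decide)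
  have he : RunsIn (tail 2) (.pair (.pair (.num δ) (.ofComplex z))
      (.pair (.ofComplex (spiral δ ^ spiralIndex δ z)) (.ofNat (spiralIndex δ z))))
      (.ofNat (spiralIndex δ z)) 5 := runsIn_of_eval rfl rfl (by decide)
  exact (hs.seq (hr.seq he)).mono (by omega)

/-! ### The integer weights -/

/-- The digits of one row, in reverse order, and an update of the base. -/
def rowDigits : Prog :=
  fold (.seq (.pair (.seq (.pair .fst (nth 1)) spiralSearch) (tail 2))
    (.pair (plus (nth 1) .fst) (.pair .fst (tail 2))))

/-- From `(δ, rows)` to the base and the digits of all rows. -/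
def allDigits : Prog :=
  .seq (.pair .fst (.pair .snd (.pair (.const 2) .nil)))
    (fold (.seq (.pair (.seq (.pair .fst (.pair (nth 1) (.pair (nth 2) .nil))) rowDigits) (tail 3))
      (.pair (.seq .fst .fst) (.pair (.seq .fst .snd) .snd))))

/-- From `(base, digits)` to the sum of the weights plus one and the list of the weights. -/
def packDigits : Prog :=
  .seq (.pair .fst (.pair .snd (.pair (.const 1) .nil)))
    (fold (.seq
      (.pair (.seq (.pair .fst (.pair (nth 1) (.const 0)))
        (fold (plus (nth 1) (times .fst (tail 2))))) (tail 2))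
      (.pair (plus (nth 1) .fst) (.pair .fst (tail 2)))))

theorem foldl_digits {α : Type*} (g : α → ℕ) (l : List α) (b : ℕ) (l' : List ℕ) :
    l.foldl (fun (acc : ℕ × List ℕ) a => (acc.1 + g a, g a :: acc.2)) (b, l')
      = (b + (l.map g).sum, (l.map g).reverse ++ l') := by
  induction l generalizing b l' with
  | nil => simp
  | cons a l ih => simp [ih, add_assoc]

theorem runsIn_rowDigits {δ : ℝ} (h0 : 0 < δ) (h1 : δ ≤ 1) {M : ℕ} (row : List ℂ)
    (hrow : ∀ z ∈ row, ‖z‖ ≤ 1 ∧ spiralIndex δ z ≤ M) (b : ℕ) :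
    RunsIn rowDigits
      (.pair (.num δ) (.pair (.ofList (row.map Val.ofComplex)) (.pair (.ofNat b) .nil)))
      (.pair (.ofNat (b + (row.map (spiralIndex δ)).sum))
        (.ofNats (row.map (spiralIndex δ)).reverse))
      (row.length * ((M + 1) * 400) + 20) := by
  have h := RunsIn.foldl (step := .seq (.pair (.seq (.pair .fst (nth 1)) spiralSearch) (tail 2))
    (.pair (plus (nth 1) .fst) (.pair .fst (tail 2)))) (env := .num δ)
    (T := (M + 1) * 300 + 50) (encA := Val.ofComplex)
    (encB := fun acc : ℕ × List ℕ => .pair (.ofNat acc.1) (.ofNats acc.2))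
    (f := fun acc z => (acc.1 + spiralIndex δ z, spiralIndex δ z :: acc.2)) row (by
      rintro z hz ⟨b, l⟩
      have e1 : RunsIn (.pair .fst (nth 1))
          (.pair (.num δ) (.pair (.ofComplex z) (.pair (.ofNat b) (.ofNats l))))
          (.pair (.num δ) (.ofComplex z)) 10 := runsIn_of_eval rfl rfl (by decide)
      have e2 : RunsIn (tail 2)
          (.pair (.num δ) (.pair (.ofComplex z) (.pair (.ofNat b) (.ofNats l))))
          (.pair (.ofNat b) (.ofNats l)) 5 := runsIn_of_eval rfl rfl (by decide)
      have e3 : RunsIn (.pair (plus (nth 1) .fst) (.pair .fst (tail 2)))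
          (.pair (.ofNat (spiralIndex δ z)) (.pair (.ofNat b) (.ofNats l)))
          (.pair (.ofNat (b + spiralIndex δ z)) (.ofNats (spiralIndex δ z :: l))) 20 :=
        runsIn_of_eval rfl (by simp [Val.ofNat, Val.ofNats, Val.ofList]) (by decide)
      exact (((e1.seq (runsIn_spiralSearch h0 h1 (hrow z hz).1 (hrow z hz).2)).pair e2).seq
        e3).mono (by omega)) (b, [])
  rw [foldl_digits, List.append_nil] at h
  exact h.mono (by nlinarith)

theorem foldl_rows {α : Type*} (g : α → ℕ) (D : α → List ℕ) (l : List α) (b : ℕ)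
    (l' : List (List ℕ)) :
    l.foldl (fun (acc : ℕ × List (List ℕ)) a => (acc.1 + g a, D a :: acc.2)) (b, l')
      = (b + (l.map g).sum, (l.map D).reverse ++ l') := by
  induction l generalizing b l' with
  | nil => simp
  | cons a l ih => simp [ih, add_assoc]

/-- The packing base is accumulated along with the digits. It starts at 2, hence exceeds 1 even if
all digits vanish. The folds leave both the rows and the digits within each row reversed. -/
theorem runsIn_allDigits {δ : ℝ} (h0 : 0 < δ) (h1 : δ ≤ 1) {L M : ℕ} (rows : List (List ℂ))
    (hrows : ∀ row ∈ rows, row.length = L ∧ ∀ z ∈ row, ‖z‖ ≤ 1 ∧ spiralIndex δ z ≤ M) :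
    RunsIn allDigits
      (.pair (.num δ) (.ofList (rows.map fun row => .ofList (row.map Val.ofComplex))))
      (.pair (.ofNat (2 + (rows.map fun row => (row.map (spiralIndex δ)).sum).sum))
        (.ofList ((rows.map fun row => (row.map (spiralIndex δ)).reverse).reverse.map .ofNats)))
      (rows.length * (L * ((M + 1) * 400) + 120) + 40) := by
  have h := RunsIn.foldl
    (step := .seq
      (.pair (.seq (.pair .fst (.pair (nth 1) (.pair (nth 2) .nil))) rowDigits) (tail 3))
      (.pair (.seq .fst .fst) (.pair (.seq .fst .snd) .snd))) (env := .num δ)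
    (T := L * ((M + 1) * 400) + 80) (encA := fun row => .ofList (row.map Val.ofComplex))
    (encB := fun acc : ℕ × List (List ℕ) => .pair (.ofNat acc.1) (.ofList (acc.2.map .ofNats)))
    (f := fun acc row => (acc.1 + (row.map (spiralIndex δ)).sum,
      (row.map (spiralIndex δ)).reverse :: acc.2)) rows (by
      rintro row hrow ⟨b, l⟩
      set v : Val := .pair (.num δ) (.pair (.ofList (row.map Val.ofComplex))
        (.pair (.ofNat b) (.ofList (l.map .ofNats)))) with hv
      have e1 : RunsIn (.pair .fst (.pair (nth 1) (.pair (nth 2) .nil))) v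
          (.pair (.num δ) (.pair (.ofList (row.map Val.ofComplex)) (.pair (.ofNat b) .nil))) 20 :=
        runsIn_of_eval rfl rfl (by decide)
      have e2 : RunsIn (tail 3) v (.ofList (l.map .ofNats)) 7 := runsIn_of_eval rfl rfl (by decide)
      have e3 := runsIn_rowDigits h0 h1 row (hrows row hrow).2 b
      rw [(hrows row hrow).1] at e3
      have e4 : RunsIn (.pair (.seq .fst .fst) (.pair (.seq .fst .snd) .snd))
          (.pair (.pair (.ofNat (b + (row.map (spiralIndex δ)).sum))
            (.ofNats (row.map (spiralIndex δ)).reverse)) (.ofList (l.map .ofNats)))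
          (.pair (.ofNat (b + (row.map (spiralIndex δ)).sum))
            (.ofList (((row.map (spiralIndex δ)).reverse :: l).map .ofNats))) 20 :=
        runsIn_of_eval rfl rfl (by decide)
      exact (((e1.seq e3).pair e2).seq e4).mono (by omega)) (2, [])
  rw [foldl_rows, List.append_nil] at h
  have hs : RunsIn (.pair .fst (.pair .snd (.pair (.const 2) .nil)))
      (.pair (.num δ) (.ofList (rows.map fun row => .ofList (row.map Val.ofComplex))))
      (.pair (.num δ) (.pair (.ofList (rows.map fun row => .ofList (row.map Val.ofComplex)))
        (.pair (.ofNat 2) .nil))) 10 :=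
    runsIn_of_eval rfl (by simp [Val.ofNat]) (by decide)
  exact (hs.seq h).mono (by nlinarith)

theorem runsIn_packDigits {L : ℕ} (B : ℕ) (rows : List (List ℕ)) (hrows : ∀ l ∈ rows, l.length = L) :
    RunsIn packDigits
      (.pair (.ofNat B) (.ofList ((rows.map List.reverse).reverse.map .ofNats)))
      (.pair (.ofNat (1 + (rows.map (Nat.ofDigits B)).sum)) (.ofNats (rows.map (Nat.ofDigits B))))
      (rows.length * (L * 100 + 120) + 40) := by
  have h := RunsIn.foldl
    (step := .seq
      (.pair (.seq (.pair .fst (.pair (nth 1) (.const 0)))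
        (fold (plus (nth 1) (times .fst (tail 2))))) (tail 2))
      (.pair (plus (nth 1) .fst) (.pair .fst (tail 2)))) (env := .ofNat B)
    (T := L * 100 + 80) (encA := Val.ofNats)
    (encB := fun acc : ℕ × List ℕ => .pair (.ofNat acc.1) (.ofNats acc.2))
    (f := fun acc l => (acc.1 + Nat.ofDigits B l.reverse, Nat.ofDigits B l.reverse :: acc.2))
    (rows.map List.reverse).reverse (by
      rintro l hl ⟨b, ws⟩
      have hlen : l.length = L := by
        simp only [List.mem_reverse, List.mem_map] at hl
        obtain ⟨l', hl', rfl⟩ := hl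
        simpa using hrows l' hl'
      set v : Val := .pair (.ofNat B) (.pair (.ofNats l) (.pair (.ofNat b) (.ofNats ws)))
      have e1 : RunsIn (.pair .fst (.pair (nth 1) (.const 0))) v
          (.pair (.ofNat B) (.pair (.ofNats l) (.ofNat 0))) 15 :=
        runsIn_of_eval rfl (by simp [v, Val.ofNat]) (by decide)
      have e2 : RunsIn (tail 2) v (.pair (.ofNat b) (.ofNats ws)) 5 :=
        runsIn_of_eval rfl rfl (by decide)
      have e3 := RunsIn.foldl (step := plus (nth 1) (times .fst (tail 2))) (env := .ofNat B)
        (T := 40) (encA := Val.ofNat) (encB := Val.ofNat) (f := fun w m => m + B * w) l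
        (fun a _ b => runsIn_of_eval rfl (by simp [Val.ofNat]) (by decide)) 0
      -- Horner's scheme: the reversed row has its most significant digit first. The outer fold in
      -- turn restores the order of the rows.
      have e4 : l.foldl (fun w m => m + B * w) 0 = Nat.ofDigits B l.reverse := by
        rw [Nat.ofDigits_eq_foldr, List.foldr_reverse]
        rfl
      rw [e4] at e3
      have e5 : RunsIn (.pair (plus (nth 1) .fst) (.pair .fst (tail 2)))
          (.pair (.ofNat (Nat.ofDigits B l.reverse)) (.pair (.ofNat b) (.ofNats ws)))
          (.pair (.ofNat (b + Nat.ofDigits B l.reverse))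
            (.ofNats (Nat.ofDigits B l.reverse :: ws))) 20 :=
        runsIn_of_eval rfl (by simp [Val.ofNat, Val.ofNats, Val.ofList]) (by decide)
      exact (((e1.seq e3).pair e2).seq e5).mono (by omega)) (1, [])
  have e : (rows.map List.reverse).reverse.map (fun l => Nat.ofDigits B l.reverse)
      = (rows.map (Nat.ofDigits B)).reverse := by
    rw [List.map_reverse, List.map_map]
    simp only [Function.comp_def, List.reverse_reverse]
  rw [foldl_digits, e, List.sum_reverse, List.reverse_reverse, List.append_nil] at h
  have hs : RunsIn (.pair .fst (.pair .snd (.pair (.const 1) .nil)))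
      (.pair (.ofNat B) (.ofList ((rows.map List.reverse).reverse.map .ofNats)))
      (.pair (.ofNat B) (.pair (.ofList ((rows.map List.reverse).reverse.map .ofNats))
        (.pair (.ofNat 1) .nil))) 10 :=
    runsIn_of_eval rfl (by simp [Val.ofNat]) (by decide)
  have h' := (hs.seq h).mono (T := rows.length * (L * 100 + 120) + 40) (by
    simp only [List.length_reverse, List.length_map]
    nlinarith)
  exact h'

end Prog

/-- The base used for packing the digits. -/
noncomputable def packBase {n L : ℕ} (δ : ℝ) (α : Fin n → Fin L → ℂ) : ℕ :=
  2 + ∑ e, ∑ k, spiralIndex δ (α e k)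

/-- The integer weight of an element. -/
noncomputable def packWeight {n L : ℕ} (δ : ℝ) (α : Fin n → Fin L → ℂ) (e : Fin n) : ℕ :=
  Nat.ofDigits (packBase δ α) (List.ofFn fun k => spiralIndex δ (α e k))

namespace Prog

theorem runsIn_weights {n L M : ℕ} {δ : ℝ} (h0 : 0 < δ) (h1 : δ ≤ 1) (α : Fin n → Fin L → ℂ)
    (hα : ∀ e k, ‖α e k‖ ≤ 1) (hM : ∀ e k, spiralIndex δ (α e k) ≤ M) :
    RunsIn (.seq allDigits packDigits)
      (.pair (.num δ) (.ofSeq fun e => .ofSeq fun k => .ofComplex (α e k)))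
      (.pair (.ofNat (1 + ∑ e, packWeight δ α e)) (.ofNats (List.ofFn (packWeight δ α))))
      (n * (L * ((M + 1) * 500) + 240) + 100) := by
  have e1 := runsIn_allDigits (L := L) (M := M) h0 h1 (List.ofFn fun e => List.ofFn (α e)) (by
    intro row hrow
    rw [List.mem_ofFn] at hrow
    obtain ⟨e, rfl⟩ := hrow
    refine ⟨by simp, fun z hz => ?_⟩
    rw [List.mem_ofFn] at hz
    obtain ⟨k, rfl⟩ := hz
    exact ⟨hα e k, hM e k⟩)
  have e2 := runsIn_packDigits (L := L) (packBase δ α)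
    (List.ofFn fun e => List.ofFn fun k => spiralIndex δ (α e k)) (by
    intro row hrow
    rw [List.mem_ofFn] at hrow
    obtain ⟨e, rfl⟩ := hrow
    simp)
  simp only [List.map_ofFn, List.sum_ofFn, List.length_ofFn, Function.comp_def, packBase]
    at e1 e2
  rw [List.map_reverse, List.map_ofFn] at e1 e2
  have : n * L * 1 ≤ n * L * (M + 1) := by gcongr; omega
  exact (e1.seq e2).mono (by nlinarith)

end Prog

/-! ### Finding a solution of given weight -/

namespace Prog

/-- One step of the search for a solution of weight `K`, with the oracle `p`. The environment is
`(descr, Big, K)`, the element is its weight, the accumulator consists of the remaining weights and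
of the reversed list of the new weights. -/
def excludeStep (p : Prog) : Prog :=
  .cond
    (.seq (.pair (.seq .fst .fst) (.pair
      (.seq (.pair .nil (.pair (tail 3) (.pair (.seq .fst (nth 1)) (.seq (nth 2) .snd))))
        (fold .snd))
      (.seq .fst (tail 2)))) p)
    (.pair (.seq (nth 2) .snd) (.pair (.seq .fst (nth 1)) (tail 3)))
    (.pair (.seq (nth 2) .snd) (.pair (nth 1) (tail 3)))

/-- From `((descr, Big, K), weights)` to the indicator of a solution of weight `K`. -/
def chooseSolution (p : Prog) : Prog :=
  .seq
    (.pair .fst (.seq (.pair .fst (.pair .snd (.pair .snd .nil))) (fold (excludeStep p))))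
    (.seq (.pair (.seq .fst (nth 1)) (.pair (tail 2) .nil))
      (fold (.pair (.cond (lt (nth 1) .fst) (.const 1) (.const 0)) (tail 2))))

end Prog

/-- The oracle program `p` decides, within `T` steps, the exact version on the instance with the
feasible family `F` and the description `descr`, for all integers up to `X`. -/
def IsOracle (p : Prog) {n : ℕ} (F : Set (Finset (Fin n))) (descr : Val) (X T : ℕ) : Prop :=
  ∀ (w : Fin n → ℕ) (K : ℕ), K ≤ X → (∀ e, w e ≤ X) →
    ∃ r, RunsIn p (.pair descr (.pair (.ofNats (List.ofFn w)) (.ofNat K))) r T ∧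
      (r ≠ .nil ↔ ∃ S ∈ F, ∑ e ∈ S, w e = K)

/-- The weights after the elements of `E` have been made too heavy. -/
def excludeWeight {n : ℕ} (w : Fin n → ℕ) (X : ℕ) (E : Finset (Fin n)) (e : Fin n) : ℕ :=
  if e ∈ E then X else w e

/-- A single element of weight `X > K` already overshoots the target, so a solution of weight `K`
must avoid `E`. Thus the oracle can answer questions about forbidden elements. -/
theorem exists_sum_excludeWeight_iff {n : ℕ} (F : Set (Finset (Fin n))) (w : Fin n → ℕ) {X K : ℕ}
    (hK : K < X) (E : Finset (Fin n)) :
    (∃ S ∈ F, ∑ e ∈ S, excludeWeight w X E e = K)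
      ↔ ∃ S ∈ F, Disjoint S E ∧ ∑ e ∈ S, w e = K := by
  have key : ∀ S : Finset (Fin n), Disjoint S E →
      ∑ e ∈ S, excludeWeight w X E e = ∑ e ∈ S, w e := fun S hS =>
    Finset.sum_congr rfl fun e he => if_neg (Finset.disjoint_left.1 hS he)
  constructor
  · rintro ⟨S, hS, h⟩
    have hd : Disjoint S E := by
      rw [Finset.disjoint_left]
      intro e he heE
      have h1 : excludeWeight w X E e ≤ ∑ e ∈ S, excludeWeight w X E e :=
        Finset.single_le_sum (f := excludeWeight w X E) (fun _ _ => Nat.zero_le _) he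
      rw [h, excludeWeight, if_pos heE] at h1
      omega
    exact ⟨S, hS, hd, by rw [← key S hd, h]⟩
  · rintro ⟨S, hS, hd, h⟩
    exact ⟨S, hS, by rw [key S hd, h]⟩

namespace Val

theorem ofNats_drop {l : List ℕ} {k : ℕ} (hk : k < l.length) :
    ofNats (l.drop k) = pair (ofNat l[k]) (ofNats (l.drop (k + 1))) := by
  rw [List.drop_eq_getElem_cons hk]
  rfl

theorem ofNats_take_reverse {l : List ℕ} {k : ℕ} (hk : k < l.length) :
    ofNats (l.take (k + 1)).reverse = pair (ofNat l[k]) (ofNats (l.take k).reverse) := by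
  rw [List.take_succ_eq_append_getElem hk, List.reverse_append]
  rfl

end Val

namespace Prog

theorem runsIn_excludeStep {p : Prog} {n : ℕ} {F : Set (Finset (Fin n))} {descr : Val}
    {w : Fin n → ℕ} {X K T : ℕ} (hp : IsOracle p F descr X T) (hw : ∀ e, w e ≤ X) (hK : K < X)
    (E : Finset (Fin n)) (k : Fin n) (hE : ∀ e ∈ E, e < k) :
    ∃ E', ((E' = E ∧ ¬ ∃ S ∈ F, Disjoint S (insert k E) ∧ ∑ e ∈ S, w e = K) ∨
        (E' = insert k E ∧ ∃ S ∈ F, Disjoint S (insert k E) ∧ ∑ e ∈ S, w e = K)) ∧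
      RunsIn (excludeStep p)
        (.pair (.pair descr (.pair (.ofNat X) (.ofNat K))) (.pair (.ofNat (w k))
          (.pair (.ofNats ((List.ofFn w).drop k))
            (.ofNats ((List.ofFn (excludeWeight w X E)).take k).reverse))))
        (.pair (.ofNats ((List.ofFn w).drop (k + 1)))
          (.ofNats ((List.ofFn (excludeWeight w X E')).take (k + 1)).reverse))
        (T + n * 41 + 150) := by
  set v : Val := .pair (.pair descr (.pair (.ofNat X) (.ofNat K))) (.pair (.ofNat (w k))
    (.pair (.ofNats ((List.ofFn w).drop k))
      (.ofNats ((List.ofFn (excludeWeight w X E)).take k).reverse))) with hv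
  rw [Val.ofNats_drop (by simp), List.getElem_ofFn] at hv
  -- Weights before `k` are already settled, `k` is tentatively forbidden, and later weights are
  -- still original since `E` contains only elements below `k`.
  have hquery : (List.ofFn (excludeWeight w X E)).take k ++ X :: (List.ofFn w).drop (k + 1)
      = List.ofFn (excludeWeight w X (insert k E)) := by
    apply List.ext_getElem
    · simp
      omega
    · intro j hj hj'
      rw [List.length_ofFn] at hj'
      rw [List.getElem_append]
      split_ifs with h
      · have h' : j < k := by simpa using h
        simp [excludeWeight, Fin.ext_iff, h'.ne]
      · have h' : (k : ℕ) ≤ j := by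
          simp only [List.length_take, List.length_ofFn, lt_min_iff, not_and_or, not_lt] at h
          omega
        have hl : ((List.ofFn (excludeWeight w X E)).take k).length = k := by simp
        rcases h'.eq_or_lt with h1 | h1
        · simp [hl, ← h1, excludeWeight]
        · obtain ⟨i, rfl⟩ : ∃ i, j = k + 1 + i := ⟨j - (k + 1), by omega⟩
          have hE' : (⟨k + 1 + i, hj'⟩ : Fin n) ∉ E := fun hmem => by
            have := Fin.lt_def.1 (hE _ hmem)
            simp at this
            omega
          have hk' : (⟨k + 1 + i, hj'⟩ : Fin n) ≠ k := fun h => by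
            have := Fin.ext_iff.1 h
            simp at this
            omega
          have hi : (k : ℕ) + 1 + i - k = i + 1 := by omega
          simp [hl, hi, excludeWeight, hE', hk']
  have e0 : RunsIn (.pair .nil (.pair (tail 3) (.pair (.seq .fst (nth 1)) (.seq (nth 2) .snd)))) v
      (.pair .nil (.pair (.ofNats ((List.ofFn (excludeWeight w X E)).take k).reverse)
        (.pair (.ofNat X) (.ofNats ((List.ofFn w).drop (k + 1)))))) 30 :=
    runsIn_of_eval rfl (by rw [hv]; rfl) (by decide)
  have e1 := runsIn_reverseAppend .nil
    ((((List.ofFn (excludeWeight w X E)).take k).reverse).map .ofNat)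
    ((X :: (List.ofFn w).drop (k + 1)).map .ofNat)
  rw [← List.map_reverse, List.reverse_reverse, ← List.map_append, hquery] at e1
  have e2 := (e0.seq e1).mono (T := n * 41 + 60) (by simp; omega)
  have e3 : RunsIn (.seq .fst .fst) v descr 3 := runsIn_of_eval rfl (by rw [hv]; rfl) (by decide)
  have e4 : RunsIn (.seq .fst (tail 2)) v (.ofNat K) 7 :=
    runsIn_of_eval rfl (by rw [hv]; rfl) (by decide)
  obtain ⟨r, hr, hr'⟩ := hp (excludeWeight w X (insert k E)) K hK.le fun e => by
    unfold excludeWeight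
    split_ifs
    exacts [le_rfl, hw e]
  rw [exists_sum_excludeWeight_iff F w hK] at hr'
  have e5 := (e3.pair (e2.pair e4)).seq hr
  have kE : k ∉ E := fun h => lt_irrefl _ (hE k h)
  by_cases hS : ∃ S ∈ F, Disjoint S (insert k E) ∧ ∑ e ∈ S, w e = K
  · refine ⟨insert k E, Or.inr ⟨rfl, hS⟩, ?_⟩
    have e6 : RunsIn (.pair (.seq (nth 2) .snd) (.pair (.seq .fst (nth 1)) (tail 3))) v
        (.pair (.ofNats ((List.ofFn w).drop (k + 1)))
          (.ofNats ((List.ofFn (excludeWeight w X (insert k E))).take (k + 1)).reverse)) 30 := by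
      refine runsIn_of_eval rfl ?_ (by decide)
      have ht : (List.ofFn (excludeWeight w X (insert k E))).take k
          = (List.ofFn (excludeWeight w X E)).take k := by
        rw [← hquery, List.take_append_of_le_length (by simp), List.take_take, min_self]
      rw [Val.ofNats_take_reverse (by simp), ht, List.getElem_ofFn]
      simp only [excludeWeight, Finset.mem_insert, true_or, if_true, Fin.eta]
      rw [hv]
      rfl
    exact (RunsIn.cond_true e5 (hr'.2 hS) e6).mono (by omega)
  · refine ⟨E, Or.inl ⟨rfl, hS⟩, ?_⟩
    have hnil : r = .nil := not_not.1 fun h => hS (hr'.1 h)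
    rw [hnil] at e5
    have e6 : RunsIn (.pair (.seq (nth 2) .snd) (.pair (nth 1) (tail 3))) v
        (.pair (.ofNats ((List.ofFn w).drop (k + 1)))
          (.ofNats ((List.ofFn (excludeWeight w X E)).take (k + 1)).reverse)) 30 := by
      refine runsIn_of_eval rfl ?_ (by decide)
      rw [Val.ofNats_take_reverse (by simp), List.getElem_ofFn]
      simp only [excludeWeight, Fin.eta, kE, if_false]
      rw [hv]
      rfl
    exact (RunsIn.cond_false e5 e6).mono (by omega)

/-- Self-reduction from decision to search: forbid elements greedily as long as a solution of weight
`K` survives. What is not forbidden is then itself a solution; no closure property of `F` is needed.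
-/
theorem runsIn_chooseSolution {p : Prog} {n : ℕ} {F : Set (Finset (Fin n))} {descr : Val}
    {w : Fin n → ℕ} {X K T : ℕ} (hp : IsOracle p F descr X T) (hw : ∀ e, w e < X) (hK : K < X)
    (hF : ∃ S ∈ F, ∑ e ∈ S, w e = K) :
    ∃ S ∈ F, ∑ e ∈ S, w e = K ∧
      RunsIn (chooseSolution p)
        (.pair (.pair descr (.pair (.ofNat X) (.ofNat K))) (.ofNats (List.ofFn w)))
        (.ofSet S) (n * (T + n * 41 + 300) + 100) := by
  obtain ⟨r, hr, E, hEk, hE, hmax, rfl⟩ := RunsIn.fold (step := excludeStep p)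
    (env := .pair descr (.pair (.ofNat X) (.ofNat K))) (T := T + n * 41 + 150)
    ((List.ofFn w).map .ofNat)
    (fun k v => ∃ E : Finset (Fin n), (∀ e ∈ E, (e : ℕ) < k) ∧
      (∃ S ∈ F, Disjoint S E ∧ ∑ e ∈ S, w e = K) ∧
      (∀ e : Fin n, (e : ℕ) < k → e ∉ E →
        ¬ ∃ S ∈ F, Disjoint S (insert e E) ∧ ∑ e ∈ S, w e = K) ∧
      v = .pair (.ofNats ((List.ofFn w).drop k))
        (.ofNats ((List.ofFn (excludeWeight w X E)).take k).reverse)) (by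
      rintro k hk _ ⟨E, hEk, hE, hmax, rfl⟩
      have hk' : k < n := by simpa using hk
      obtain ⟨E', hE', h⟩ := runsIn_excludeStep hp (fun e => (hw e).le) hK E ⟨k, hk'⟩
        fun e he => Fin.lt_def.2 (hEk e he)
      rw [List.getElem_map, List.getElem_ofFn]
      refine ⟨_, h, E', ?_⟩
      rcases hE' with ⟨rfl, hno⟩ | ⟨rfl, hyes⟩
      · refine ⟨fun e he => (hEk e he).trans (Nat.lt_succ_self k), hE, fun e he heE => ?_, rfl⟩
        rcases (Nat.lt_succ_iff.1 he).eq_or_lt with h1 | h1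
        · have : e = ⟨k, hk'⟩ := Fin.ext h1
          rw [this]
          exact hno
        · exact hmax e h1 heE
      · refine ⟨fun e he => ?_, hyes, fun e he heE => ?_, rfl⟩
        · rcases Finset.mem_insert.1 he with rfl | he
          · exact Nat.lt_succ_self k
          · exact (hEk e he).trans (Nat.lt_succ_self k)
        · rw [Finset.mem_insert, not_or] at heE
          have h1 : (e : ℕ) < k :=
            lt_of_le_of_ne (Nat.lt_succ_iff.1 he) fun h => heE.1 (Fin.ext h)
          rintro ⟨S, hS, hd, hs⟩
          -- A failed exclusion stays failed, since enlarging `E` only removes candidates.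
          exact hmax e h1 heE.2 ⟨S, hS, hd.mono_right
            (Finset.insert_subset_insert _ (Finset.subset_insert _ _)), hs⟩)
    (.pair (.ofNats (List.ofFn w)) .nil)
    ⟨∅, by simp, by simpa using hF, by simp, rfl⟩
  obtain ⟨S, hS, hd, hsum⟩ := hE
  -- An element outside both `S` and `E` could still be forbidden with `S` surviving, contrary to
  -- maximality.
  have hSE : S = Eᶜ := by
    ext e
    rw [Finset.mem_compl]
    refine ⟨fun he => Finset.disjoint_left.1 hd he, fun heE => ?_⟩
    by_contra heS
    exact hmax e (by simp) heE ⟨S, hS, by rw [Finset.disjoint_insert_right]; exact ⟨heS, hd⟩, hsum⟩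
  refine ⟨S, hS, hsum, ?_⟩
  have e1 : RunsIn (.pair .fst (.pair .snd (.pair .snd .nil)))
      (.pair (.pair descr (.pair (.ofNat X) (.ofNat K))) (.ofNats (List.ofFn w)))
      (.pair (.pair descr (.pair (.ofNat X) (.ofNat K)))
        (.pair (.ofNats (List.ofFn w)) (.pair (.ofNats (List.ofFn w)) .nil))) 10 :=
    runsIn_of_eval rfl rfl (by decide)
  have e2 : RunsIn .fst
      (.pair (.pair descr (.pair (.ofNat X) (.ofNat K))) (.ofNats (List.ofFn w)))
      (.pair descr (.pair (.ofNat X) (.ofNat K))) 1 := runsIn_of_eval rfl rfl (by decide)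
  simp only [List.length_map, List.length_ofFn] at hr
  have e3 := e2.pair (e1.seq hr)
  set l := (List.ofFn (excludeWeight w X E)).reverse with hl
  have hl' : ((List.ofFn (excludeWeight w X E)).take n).reverse = l := by
    rw [List.take_of_length_le (by simp)]
  rw [hl'] at e3
  have e4 : RunsIn (.pair (.seq .fst (nth 1)) (.pair (tail 2) .nil))
      (.pair (.pair descr (.pair (.ofNat X) (.ofNat K)))
        (.pair (.ofNats ((List.ofFn w).drop n)) (.ofNats l)))
      (.pair (.ofNat X) (.pair (.ofNats l) .nil)) 20 := runsIn_of_eval rfl rfl (by decide)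
  have e5 := RunsIn.foldl (step := .pair (.cond (lt (nth 1) .fst) (.const 1) (.const 0)) (tail 2))
    (env := .ofNat X) (T := 40) (encA := Val.ofNat) (encB := Val.ofList)
    (f := fun acc a => .num (if a < X then 1 else 0) :: acc) l (fun a _ acc => by
      refine runsIn_of_eval rfl ?_ (by decide)
      by_cases h : a < X
      · simp [Val.ofNat, h, Val.ofList]
      · simp [Val.ofNat, h, Val.ofList]) []
  -- The indicator can be read off the final weights: the original ones are below `X`, the forbidden
  -- ones equal `X`. Folding the reversed list restores the order of the elements.
  have e6 : l.foldl (fun acc a => .num (if a < X then 1 else 0) :: acc) []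
      = List.ofFn fun e => Val.num (if e ∈ S then 1 else 0) := by
    rw [hl, List.foldl_reverse, List.foldr_cons_eq_append, List.append_nil, List.map_ofFn]
    congr 1
    funext e
    by_cases h : e ∈ E <;> simp [excludeWeight, h, hSE, hw e]
  rw [e6] at e5
  have hlen : l.length = n := by simp [hl]
  rw [hlen] at e5
  exact (e3.seq (e4.seq e5)).mono (by nlinarith)

/-! ### Evaluating a solution -/

/-- From `(row, values)` to the list of the products. -/
def mulLists : Prog :=
  .seq (.seq (.pair .nil (.pair .fst (.pair .snd .nil)))
    (fold (.pair (.seq (nth 2) .snd)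
      (.pair (cmul (.seq (nth 2) .fst) (nth 1)) (tail 3)))))
    (.seq (.pair .nil (.pair .snd .nil)) (fold .snd))

/-- From `(indicator, coefficients, rows)` to the squared absolute value of the solution value. -/
def evalSolution : Prog :=
  .seq (.seq (.pair .nil (.pair (tail 2) (.pair .fst (nth 1))))
    (fold (.cond (lt (.const 0) (.seq (nth 2) .fst))
      (.pair (.seq (nth 2) .snd) (.seq (.pair (nth 1) (tail 3)) mulLists))
      (.pair (.seq (nth 2) .snd) (tail 3)))))
    (.seq (.seq (.pair .nil (.pair .snd (.pair (.const 0) (.const 0))))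
      (fold (cadd (tail 2) (nth 1)))) (cnormSq .id))

theorem runsIn_mulLists {L : ℕ} (x y : Fin L → ℂ) :
    RunsIn mulLists
      (.pair (.ofSeq fun k => .ofComplex (x k)) (.ofSeq fun k => .ofComplex (y k)))
      (.ofSeq fun k => .ofComplex (y k * x k)) (L * 250 + 100) := by
  set l := List.ofFn fun k => Val.ofComplex (y k) with hl
  set m := List.ofFn fun k => Val.ofComplex (y k * x k) with hm
  have hll : l.length = L := by simp [hl]
  have hml : m.length = L := by simp [hm]
  obtain ⟨r, hr, rfl⟩ := RunsIn.fold (step := .pair (.seq (nth 2) .snd)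
      (.pair (cmul (.seq (nth 2) .fst) (nth 1)) (tail 3))) (env := .nil) (T := 160)
    (List.ofFn fun k => Val.ofComplex (x k))
    (fun k v => v = .pair (.ofList (l.drop k)) (.ofList (m.take k).reverse)) (by
      rintro k hk _ rfl
      have hk' : k < L := by simpa using hk
      refine ⟨_, ?_, rfl⟩
      refine runsIn_of_eval rfl ?_ (by decide)
      rw [List.drop_eq_getElem_cons (by omega), List.take_succ_eq_append_getElem (by omega),
        List.reverse_append]
      simp [hl, hm, cmul, Val.ofList, Val.ofComplex])
    (.pair (.ofList l) .nil) (by simp [Val.ofList])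
  simp only [List.length_ofFn] at hr
  rw [List.take_of_length_le hml.le] at hr
  have e1 : RunsIn (.pair .nil (.pair .fst (.pair .snd .nil)))
      (.pair (.ofSeq fun k => .ofComplex (x k)) (.ofList l))
      (.pair .nil (.pair (.ofSeq fun k => .ofComplex (x k)) (.pair (.ofList l) .nil))) 10 :=
    runsIn_of_eval rfl rfl (by decide)
  have e2 : RunsIn (.pair .nil (.pair .snd .nil))
      (.pair (.ofList (l.drop L)) (.ofList m.reverse))
      (.pair .nil (.pair (.ofList m.reverse) (.ofList []))) 10 :=
    runsIn_of_eval rfl rfl (by decide)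
  have e3 := runsIn_reverseAppend .nil m.reverse []
  rw [List.reverse_reverse, List.append_nil, List.length_reverse, hml] at e3
  exact ((e1.seq hr).seq (e2.seq e3)).mono (by omega)

theorem runsIn_evalSolution {n L : ℕ} (c : Fin L → ℂ) (α : Fin n → Fin L → ℂ)
    (S : Finset (Fin n)) :
    RunsIn evalSolution
      (.pair (.ofSet S) (.pair (.ofSeq fun k => .ofComplex (c k))
        (.ofSeq fun e => .ofSeq fun k => .ofComplex (α e k))))
      (.num (‖solutionValue c α S‖ ^ 2)) (n * (L * 250 + 250) + L * 100 + 150) := by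
  set rows := List.ofFn fun e => Val.ofSeq fun k => Val.ofComplex (α e k) with hrows
  set bits := List.ofFn fun e => Val.num (if e ∈ S then 1 else 0) with hbits
  have hbl : bits.length = n := by simp [hbits]
  have hrl : rows.length = n := by simp [hrows]
  obtain ⟨r, hr, rfl⟩ := RunsIn.fold (step := .cond (lt (.const 0) (.seq (nth 2) .fst))
      (.pair (.seq (nth 2) .snd) (.seq (.pair (nth 1) (tail 3)) mulLists))
      (.pair (.seq (nth 2) .snd) (tail 3))) (env := .nil) (T := L * 250 + 200) rows
    -- The coefficients are the initial accumulator, so the products come out already multiplied by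
    -- `c k` and only need to be summed.
    (fun j v => v = .pair (.ofList (bits.drop j))
      (.ofSeq fun k => .ofComplex (c k * ∏ e ∈ S.filter fun e : Fin n => (e : ℕ) < j, α e k))) (by
      rintro j hj _ rfl
      have hj' : j < n := by omega
      refine ⟨_, ?_, rfl⟩
      rw [List.drop_eq_getElem_cons (by omega)]
      have e0 : rows[j] = Val.ofSeq fun k => Val.ofComplex (α ⟨j, hj'⟩ k) := by simp [hrows]
      have e1 : bits[j] = Val.num (if (⟨j, hj'⟩ : Fin n) ∈ S then 1 else 0) := by simp [hbits]
      rw [e0, e1]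
      by_cases h : (⟨j, hj'⟩ : Fin n) ∈ S
      · have hf : (S.filter fun e : Fin n => (e : ℕ) < j + 1)
            = insert ⟨j, hj'⟩ (S.filter fun e : Fin n => (e : ℕ) < j) := by
          ext e
          simp only [Finset.mem_filter, Finset.mem_insert, Nat.lt_succ_iff_lt_or_eq, Fin.ext_iff]
          refine ⟨fun ⟨h1, h2⟩ => h2.elim (fun h3 => Or.inr ⟨h1, h3⟩) Or.inl, ?_⟩
          rintro (h1 | ⟨h1, h2⟩)
          · exact ⟨by rwa [show e = ⟨j, hj'⟩ from Fin.ext h1], Or.inr h1⟩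
          · exact ⟨h1, Or.inl h2⟩
        have hp : ∀ k, c k * ∏ e ∈ S.filter fun e : Fin n => (e : ℕ) < j + 1, α e k
            = (c k * ∏ e ∈ S.filter fun e : Fin n => (e : ℕ) < j, α e k) * α ⟨j, hj'⟩ k := by
          intro k
          rw [hf, Finset.prod_insert (by simp)]
          ring
        simp only [hp, h, if_true]
        set P := fun k => c k * ∏ e ∈ S.filter fun e : Fin n => (e : ℕ) < j, α e k
        set v : Val := .pair .nil (.pair (.ofSeq fun k => .ofComplex (α ⟨j, hj'⟩ k))
          (.pair (.ofList (.num 1 :: bits.drop (j + 1))) (.ofSeq fun k => .ofComplex (P k))))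
        have a1 : RunsIn (lt (.const 0) (.seq (nth 2) .fst)) v (.num 1) 20 :=
          runsIn_of_eval rfl (by simp [v, Val.ofList, Val.ofProp]) (by decide)
        have a2 : RunsIn (.seq (nth 2) .snd) v (.ofList (bits.drop (j + 1))) 10 :=
          runsIn_of_eval rfl rfl (by decide)
        have a3 : RunsIn (.pair (nth 1) (tail 3)) v
            (.pair (.ofSeq fun k => .ofComplex (α ⟨j, hj'⟩ k))
              (.ofSeq fun k => .ofComplex (P k))) 20 := runsIn_of_eval rfl rfl (by decide)
        exact (RunsIn.cond_true a1 (by simp) (a2.pair (a3.seq (runsIn_mulLists _ _)))).mono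
          (by omega)
      · have hf : (S.filter fun e : Fin n => (e : ℕ) < j + 1) = S.filter fun e : Fin n => (e : ℕ) < j := by
          refine Finset.filter_congr fun e he => ?_
          rw [Nat.lt_succ_iff_lt_or_eq]
          refine ⟨fun h1 => h1.resolve_right fun h2 => h ?_, Or.inl⟩
          rwa [← show e = ⟨j, hj'⟩ from Fin.ext h2]
        simp only [hf, h, if_false]
        set P := fun k => c k * ∏ e ∈ S.filter fun e : Fin n => (e : ℕ) < j, α e k
        set v : Val := .pair .nil (.pair (.ofSeq fun k => .ofComplex (α ⟨j, hj'⟩ k))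
          (.pair (.ofList (.num 0 :: bits.drop (j + 1))) (.ofSeq fun k => .ofComplex (P k))))
        have a1 : RunsIn (lt (.const 0) (.seq (nth 2) .fst)) v .nil 20 :=
          runsIn_of_eval rfl (by simp [v, Val.ofList, Val.ofProp]) (by decide)
        have a2 : RunsIn (.pair (.seq (nth 2) .snd) (tail 3)) v
            (.pair (.ofList (bits.drop (j + 1))) (.ofSeq fun k => .ofComplex (P k))) 20 :=
          runsIn_of_eval rfl rfl (by decide)
        exact (RunsIn.cond_false a1 a2).mono (by omega))
    (.pair (.ofList bits) (.ofSeq fun k => .ofComplex (c k))) (by simp)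
  have hf : (S.filter fun e : Fin n => (e : ℕ) < n) = S := Finset.filter_true_of_mem fun e _ => e.2
  simp only [hrl, hf] at hr
  have e1 : RunsIn (.pair .nil (.pair (tail 2) (.pair .fst (nth 1))))
      (.pair (.ofList bits) (.pair (.ofSeq fun k => .ofComplex (c k)) (.ofList rows)))
      (.pair .nil (.pair (.ofList rows) (.pair (.ofList bits)
        (.ofSeq fun k => .ofComplex (c k))))) 20 := runsIn_of_eval rfl rfl (by decide)
  have e2 : RunsIn (.pair .nil (.pair .snd (.pair (.const 0) (.const 0))))
      (.pair (.ofList (bits.drop n)) (.ofSeq fun k => .ofComplex (c k * ∏ e ∈ S, α e k)))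
      (.pair .nil (.pair (.ofSeq fun k => .ofComplex (c k * ∏ e ∈ S, α e k)) (.ofComplex 0))) 10 :=
    runsIn_of_eval rfl (by simp [Val.ofComplex]) (by decide)
  have e3 := RunsIn.foldl (step := cadd (tail 2) (nth 1)) (env := .nil) (T := 40)
    (encA := Val.ofComplex) (encB := Val.ofComplex) (f := fun acc z => acc + z)
    (List.ofFn fun k => c k * ∏ e ∈ S, α e k)
    (fun a _ b => runsIn_of_eval rfl (eval_cadd rfl rfl) (by decide)) 0
  rw [foldl_add_eq (fun z : ℂ => z), ← Val.ofSeq_eq_map, List.map_ofFn, List.sum_ofFn, zero_add,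
    List.length_ofFn] at e3
  have e4 : RunsIn (cnormSq .id) (.ofComplex (solutionValue c α S))
      (.num (‖solutionValue c α S‖ ^ 2)) 40 := by
    refine runsIn_of_eval rfl ?_ (by decide)
    rw [eval_cnormSq rfl, ← Complex.normSq_eq_norm_sq, Complex.normSq_apply]
  exact ((e1.seq hr).seq ((e2.seq e3).seq e4)).mono (by nlinarith)

end Prog

/-! ### The search for the best solution -/

namespace Prog

/-- Update of the best solution; the input is
`((descr, Big, weights, coefficients, rows), K, best value, best solution)`. -/
def improveBest (p : Prog) : Prog :=
  .seq (.pair .id (.seq (.pair (.pair (.seq .fst .fst) (.pair (.seq .fst (nth 1)) (nth 1)))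
    (.seq .fst (nth 2))) (chooseSolution p)))
  (.seq (.pair (.seq (.pair .snd (.seq (.seq .fst .fst) (tail 3))) evalSolution) .id)
    (.cond (lt (.seq (nth 1) (nth 2)) .fst) (.pair .fst (tail 2)) (.seq (nth 1) (tail 2))))

/-- The body of the main loop. -/
def searchStep (p : Prog) : Prog :=
  .pair .fst (.pair (plus (nth 1) (.const 1))
    (.cond (.seq (.pair (.seq .fst .fst) (.pair (.seq .fst (nth 2)) (nth 1))) p)
      (improveBest p) (tail 2)))

/-- From `(descr, Big, weights, coefficients, rows)` to the indicator of the best solution found. -/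
def searchBest (p : Prog) : Prog :=
  .seq (.pair .id (.pair (.const 0) (.pair (.const (-1)) .nil)))
    (.seq (.loop (lt (nth 1) (.seq .fst (nth 1))) (searchStep p)) (tail 3))

theorem runsIn_improveBest {p : Prog} {n L : ℕ} {F : Set (Finset (Fin n))} {descr : Val}
    {w : Fin n → ℕ} {X K T : ℕ} (hp : IsOracle p F descr X T) (hw : ∀ e, w e < X) (hK : K < X)
    (hF : ∃ S ∈ F, ∑ e ∈ S, w e = K) (c : Fin L → ℂ) (α : Fin n → Fin L → ℂ) (b : ℝ) (s : Val) :
    ∃ S ∈ F, ∑ e ∈ S, w e = K ∧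
      RunsIn (improveBest p)
        (.pair (.pair descr (.pair (.ofNat X) (.pair (.ofNats (List.ofFn w))
          (.pair (.ofSeq fun k => .ofComplex (c k))
            (.ofSeq fun e => .ofSeq fun k => .ofComplex (α e k))))))
          (.pair (.ofNat K) (.pair (.num b) s)))
        (if b < ‖solutionValue c α S‖ ^ 2 then
          .pair (.num (‖solutionValue c α S‖ ^ 2)) (.ofSet S) else .pair (.num b) s)
        (n * (T + n * 41 + L * 250 + 550) + L * 100 + 450) := by
  obtain ⟨S, hS, hSK, hrun⟩ := runsIn_chooseSolution hp hw hK hF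
  refine ⟨S, hS, hSK, ?_⟩
  set v : Val := .pair (.pair descr (.pair (.ofNat X) (.pair (.ofNats (List.ofFn w))
          (.pair (.ofSeq fun k => .ofComplex (c k))
            (.ofSeq fun e => .ofSeq fun k => .ofComplex (α e k))))))
          (.pair (.ofNat K) (.pair (.num b) s))
  have e1 : RunsIn (.pair (.pair (.seq .fst .fst) (.pair (.seq .fst (nth 1)) (nth 1)))
      (.seq .fst (nth 2))) v
      (.pair (.pair descr (.pair (.ofNat X) (.ofNat K))) (.ofNats (List.ofFn w))) 40 :=
    runsIn_of_eval rfl rfl (by decide)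
  have e2 : RunsIn .id v v 1 := runsIn_of_eval rfl rfl (by decide)
  have e3 := e2.pair (e1.seq hrun)
  have e4 : RunsIn (.pair .snd (.seq (.seq .fst .fst) (tail 3))) (.pair v (.ofSet S))
      (.pair (.ofSet S) (.pair (.ofSeq fun k => .ofComplex (c k))
        (.ofSeq fun e => .ofSeq fun k => .ofComplex (α e k)))) 20 :=
    runsIn_of_eval rfl rfl (by decide)
  have e5 : RunsIn .id (.pair v (.ofSet S)) (.pair v (.ofSet S)) 1 :=
    runsIn_of_eval rfl rfl (by decide)
  have e6 := (e4.seq (runsIn_evalSolution c α S)).pair e5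
  have e7 : RunsIn (.cond (lt (.seq (nth 1) (nth 2)) .fst) (.pair .fst (tail 2))
      (.seq (nth 1) (tail 2)))
      (.pair (.num (‖solutionValue c α S‖ ^ 2)) (.pair v (.ofSet S)))
      (if b < ‖solutionValue c α S‖ ^ 2 then
          .pair (.num (‖solutionValue c α S‖ ^ 2)) (.ofSet S) else .pair (.num b) s) 60 := by
    refine runsIn_of_eval rfl ?_ (by decide)
    by_cases h : b < ‖solutionValue c α S‖ ^ 2 <;> simp [v, h]
  exact (e3.seq (e6.seq e7)).mono (by nlinarith)

/-- Every attainable weight is below `X`, so scanning `K < X` meets the weight of each feasible `U`.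
The comparison is with the representative chosen for that weight, not with `U` itself. -/
theorem runsIn_searchBest {p : Prog} {n L : ℕ} {F : Set (Finset (Fin n))} {descr : Val}
    {w : Fin n → ℕ} {X T : ℕ} (hp : IsOracle p F descr X T) (hX : X = 1 + ∑ e, w e)
    (hF : F.Nonempty) (c : Fin L → ℂ) (α : Fin n → Fin L → ℂ) :
    ∃ S ∈ F, (∀ U ∈ F, ∃ S' ∈ F, ∑ e ∈ S', w e = ∑ e ∈ U, w e ∧
        ‖solutionValue c α S'‖ ≤ ‖solutionValue c α S‖) ∧
      RunsIn (searchBest p)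
        (.pair descr (.pair (.ofNat X) (.pair (.ofNats (List.ofFn w))
          (.pair (.ofSeq fun k => .ofComplex (c k))
            (.ofSeq fun e => .ofSeq fun k => .ofComplex (α e k))))))
        (.ofSet S)
        ((X + 1) * (T + n * (T + n * 41 + L * 250 + 550) + L * 100 + 550) + 40) := by
  set env : Val := .pair descr (.pair (.ofNat X) (.pair (.ofNats (List.ofFn w))
          (.pair (.ofSeq fun k => .ofComplex (c k))
            (.ofSeq fun e => .ofSeq fun k => .ofComplex (α e k)))))
  have hsum : ∀ U : Finset (Fin n), ∑ e ∈ U, w e < X := fun U => by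
    have := Finset.sum_le_univ_sum_of_nonneg (s := U) (f := w) fun _ => Nat.zero_le _
    omega
  have hw : ∀ e, w e < X := fun e => by simpa using hsum {e}
  obtain ⟨r, hr, b, s, rfl, hbest, hall⟩ := RunsIn.loop
    (c := lt (nth 1) (.seq .fst (nth 1))) (p := searchStep p) (S := 15)
    (T := T + n * (T + n * 41 + L * 250 + 550) + L * 100 + 530) X
    (fun K v => ∃ (b : ℝ) (s : Val), v = .pair env (.pair (.ofNat K) (.pair (.num b) s)) ∧
      (b = -1 ∨ ∃ S ∈ F, b = ‖solutionValue c α S‖ ^ 2 ∧ s = .ofSet S) ∧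
      ∀ U ∈ F, ∑ e ∈ U, w e < K → ∃ S' ∈ F, ∑ e ∈ S', w e = ∑ e ∈ U, w e ∧
        ‖solutionValue c α S'‖ ^ 2 ≤ b) (by
      rintro K hK _ ⟨b, s, rfl, hbest, hall⟩
      refine ⟨⟨.ofProp True, by simp, runsIn_of_eval rfl ?_ (by decide)⟩, ?_⟩
      · simp [env, Val.ofNat, hK]
      set v : Val := .pair env (.pair (.ofNat K) (.pair (.num b) s))
      have e1 : RunsIn .fst v env 1 := runsIn_of_eval rfl rfl (by decide)
      have e2 : RunsIn (plus (nth 1) (.const 1)) v (.ofNat (K + 1)) 9 :=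
        runsIn_of_eval rfl (by simp [v, Val.ofNat]) (by decide)
      have e3 : RunsIn (.pair (.seq .fst .fst) (.pair (.seq .fst (nth 2)) (nth 1))) v
          (.pair descr (.pair (.ofNats (List.ofFn w)) (.ofNat K))) 30 :=
        runsIn_of_eval rfl rfl (by decide)
      obtain ⟨a, ha, ha'⟩ := hp w K hK.le fun e => (hw e).le
      have e4 := e3.seq ha
      by_cases hex : ∃ S ∈ F, ∑ e ∈ S, w e = K
      · obtain ⟨S, hS, hSK, hrun⟩ := runsIn_improveBest hp hw hK hex c α b s
        have e5 := (e1.pair (e2.pair (RunsIn.cond_true (q := tail 2) e4 (ha'.2 hex) hrun))).mono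
          (T := T + n * (T + n * 41 + L * 250 + 550) + L * 100 + 530) (by omega)
        by_cases hb : b < ‖solutionValue c α S‖ ^ 2
        · rw [if_pos hb] at e5
          refine ⟨_, e5, _, _, rfl, Or.inr ⟨S, hS, rfl, rfl⟩, fun U hU hUK => ?_⟩
          rcases Nat.lt_succ_iff_lt_or_eq.1 hUK with h | h
          · obtain ⟨S', h1, h2, h3⟩ := hall U hU h
            exact ⟨S', h1, h2, h3.trans hb.le⟩
          · exact ⟨S, hS, hSK.trans h.symm, le_rfl⟩
        · rw [if_neg hb] at e5
          refine ⟨_, e5, _, _, rfl, hbest, fun U hU hUK => ?_⟩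
          rcases Nat.lt_succ_iff_lt_or_eq.1 hUK with h | h
          · exact hall U hU h
          · exact ⟨S, hS, hSK.trans h.symm, not_lt.1 hb⟩
      · have hnil : a = .nil := not_not.1 fun h => hex (ha'.1 h)
        rw [hnil] at e4
        have e6 : RunsIn (tail 2) v (.pair (.num b) s) 5 := runsIn_of_eval rfl rfl (by decide)
        refine ⟨_, (e1.pair (e2.pair (RunsIn.cond_false e4 e6))).mono (by omega), b, s, rfl, hbest,
          fun U hU hUK => hall U hU ?_⟩
        exact (Nat.lt_succ_iff_lt_or_eq.1 hUK).resolve_right fun h => hex ⟨U, hU, h⟩) (by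
      rintro _ ⟨b, s, rfl, -⟩
      refine runsIn_of_eval rfl ?_ (by decide)
      simp [env, Val.ofNat])
    (.pair env (.pair (.ofNat 0) (.pair (.num (-1)) .nil))) ⟨-1, .nil, rfl, Or.inl rfl, by simp⟩
  -- The initial value -1 lies below every squared modulus, so it cannot survive when `F` is
  -- nonempty.
  have hfound : ∃ S ∈ F, b = ‖solutionValue c α S‖ ^ 2 ∧ s = .ofSet S := by
    refine hbest.resolve_left fun hb => ?_
    obtain ⟨U, hU⟩ := hF
    obtain ⟨S', -, -, h⟩ := hall U hU (hsum U)
    have := sq_nonneg ‖solutionValue c α S'‖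
    linarith
  obtain ⟨S, hS, rfl, rfl⟩ := hfound
  refine ⟨S, hS, fun U hU => ?_, ?_⟩
  · obtain ⟨S', h1, h2, h3⟩ := hall U hU (hsum U)
    exact ⟨S', h1, h2, (sq_le_sq₀ (norm_nonneg _) (norm_nonneg _)).1 h3⟩
  · have e1 : RunsIn (.pair .id (.pair (.const 0) (.pair (.const (-1)) .nil))) env
        (.pair env (.pair (.ofNat 0) (.pair (.num (-1)) .nil))) 10 :=
      runsIn_of_eval rfl (by simp [Val.ofNat]) (by decide)
    have e2 : RunsIn (tail 3) (.pair env (.pair (.ofNat X)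
        (.pair (.num (‖solutionValue c α S‖ ^ 2)) (.ofSet S)))) (.ofSet S) 10 :=
      runsIn_of_eval rfl rfl (by decide)
    refine (e1.seq (hr.seq e2)).mono ?_
    have : (X + 1) * (15 + (T + n * (T + n * 41 + L * 250 + 550) + L * 100 + 530) + 1)
      ≤ (X + 1) * (T + n * (T + n * 41 + L * 250 + 550) + L * 100 + 550) :=
      Nat.mul_le_mul_left _ (by omega)
    omega

/-- The utility maximization algorithm with the exact oracle `p`. -/
def maximizeUtility (p : Prog) : Prog :=
  .seq (.pair .id stepSize)
    (.seq (.pair .fst (.seq (.pair .snd (.seq .fst (tail 3))) (.seq allDigits packDigits)))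
      (.seq (.pair (.seq .fst .fst) (.pair (nth 1) (.pair (tail 2) (.seq .fst (tail 2)))))
        (searchBest p)))

theorem runsIn_maximizeUtility {p : Prog} {n L M T : ℕ} {F : Set (Finset (Fin n))} {descr : Val}
    (c : Fin L → ℂ) (α : Fin n → Fin L → ℂ) {ε δ : ℝ} (hδ : δ = _root_.stepSize c n ε)
    (h0 : 0 < δ) (h1 : δ ≤ 1) (hα : ∀ e k, ‖α e k‖ ≤ 1) (hM : ∀ e k, spiralIndex δ (α e k) ≤ M)
    (hF : F.Nonempty) (hp : IsOracle p F descr (1 + ∑ e, packWeight δ α e) T) :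
    ∃ S ∈ F, (∀ U ∈ F, ∃ S' ∈ F, ∑ e ∈ S', packWeight δ α e = ∑ e ∈ U, packWeight δ α e ∧
        ‖solutionValue c α S'‖ ≤ ‖solutionValue c α S‖) ∧
      RunsIn (maximizeUtility p)
        (.pair descr (.pair (.num ε) (.pair (.ofSeq fun k => .ofComplex (c k))
          (.ofSeq fun e => .ofSeq fun k => .ofComplex (α e k)))))
        (.ofSet S)
        ((1 + ∑ e, packWeight δ α e + 1) *
          (T + n * (T + n * 41 + L * 250 + 550) + L * 100 + 550)
          + n * (L * ((M + 1) * 500) + 300) + L * 100 + 500) := by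
  obtain ⟨S, hS, hbest, hrun⟩ := runsIn_searchBest hp rfl hF c α
  refine ⟨S, hS, hbest, ?_⟩
  set v : Val := .pair descr (.pair (.num ε) (.pair (.ofSeq fun k => .ofComplex (c k))
          (.ofSeq fun e => .ofSeq fun k => .ofComplex (α e k))))
  have e1 : RunsIn .id v v 1 := runsIn_of_eval rfl rfl (by decide)
  have e2 := e1.pair
    (runsIn_stepSize c (fun e => .ofSeq fun k => .ofComplex (α e k)) descr ε)
  rw [← hδ] at e2
  have e3 : RunsIn .fst (.pair v (.num δ)) v 1 := runsIn_of_eval rfl rfl (by decide)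
  have e4 : RunsIn (.pair .snd (.seq .fst (tail 3))) (.pair v (.num δ))
      (.pair (.num δ) (.ofSeq fun e => .ofSeq fun k => .ofComplex (α e k))) 15 :=
    runsIn_of_eval rfl rfl (by decide)
  have e5 := e3.pair (e4.seq (runsIn_weights h0 h1 α hα hM))
  have e6 : RunsIn (.pair (.seq .fst .fst) (.pair (nth 1) (.pair (tail 2) (.seq .fst (tail 2)))))
      (.pair v (.pair (.ofNat (1 + ∑ e, packWeight δ α e))
        (.ofNats (List.ofFn (packWeight δ α)))))
      (.pair descr (.pair (.ofNat (1 + ∑ e, packWeight δ α e))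
        (.pair (.ofNats (List.ofFn (packWeight δ α))) (.pair (.ofSeq fun k => .ofComplex (c k))
          (.ofSeq fun e => .ofSeq fun k => .ofComplex (α e k)))))) 40 :=
    runsIn_of_eval rfl rfl (by decide)
  refine (e2.seq (e5.seq (e6.seq hrun))).mono ?_
  have : n * (L * ((M + 1) * 500) + 300) = n * (L * ((M + 1) * 500) + 240) + n * 60 := by ring
  omega

end Prog

/-! ### Running time and accuracy -/

theorem one_le_coeffBound {L : ℕ} (c : Fin L → ℂ) : 1 ≤ coeffBound c := by
  unfold coeffBound
  have : 0 ≤ ∑ k, (1 + ((c k).re * (c k).re + (c k).im * (c k).im)) :=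
    Finset.sum_nonneg fun k _ => by nlinarith [mul_self_nonneg (c k).re, mul_self_nonneg (c k).im]
  linarith

/-- From `x ≤ 1 + x ^ 2`; the squares make the bound computable without roots. -/
theorem sum_norm_le_coeffBound {L : ℕ} (c : Fin L → ℂ) : ∑ k, ‖c k‖ ≤ coeffBound c := by
  have : ∑ k, ‖c k‖ ≤ ∑ k, (1 + ((c k).re * (c k).re + (c k).im * (c k).im)) := by
    refine Finset.sum_le_sum fun k _ => ?_
    rw [← Complex.normSq_apply, Complex.normSq_eq_norm_sq]
    nlinarith [sq_nonneg (‖c k‖ - 1), norm_nonneg (c k)]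
  unfold coeffBound
  linarith

section StepSize

variable {L : ℕ} (c : Fin L → ℂ) (n : ℕ) {ε : ℝ}

theorem stepSize_pos (hε : 0 < ε) : 0 < stepSize c n ε := by
  have := one_le_coeffBound c
  unfold stepSize
  positivity

/-- The summand `ε` in the denominator gives this for every `ε`, without a case distinction in the
program. -/
theorem stepSize_le_one (hε : 0 < ε) : stepSize c n ε ≤ 1 := by
  have := one_le_coeffBound c
  unfold stepSize
  rw [div_le_one (by positivity)]
  have : 0 ≤ 40 * ((n : ℝ) + 1) * coeffBound c := by positivity
  linarith

theorem sum_norm_mul_stepSize_lt (hε : 0 < ε) :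
    (∑ k, ‖c k‖) * (20 * n * stepSize c n ε) < ε := by
  have hG := one_le_coeffBound c
  have hδ := stepSize_pos c n hε
  have hden : 0 < ε + 40 * ((n : ℝ) + 1) * coeffBound c := by positivity
  have h : stepSize c n ε * (ε + 40 * (n + 1) * coeffBound c) = ε := by
    unfold stepSize
    field_simp
  calc (∑ k, ‖c k‖) * (20 * n * stepSize c n ε) ≤ coeffBound c * (20 * n * stepSize c n ε) := by
        gcongr
        exact sum_norm_le_coeffBound c
    _ < stepSize c n ε * (ε + 40 * (n + 1) * coeffBound c) := by
        have h1 : 0 < stepSize c n ε * ε := by positivity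
        have h2 : 0 ≤ stepSize c n ε * n * coeffBound c := by positivity
        have h3 : 0 ≤ stepSize c n ε * coeffBound c := by positivity
        nlinarith
    _ = ε := h

theorem inv_stepSize_le (hε : 0 < ε) :
    1 / stepSize c n ε ≤ 81 * coeffBound c * (max 1 (n : ℝ) / min 1 ε) := by
  have hG := one_le_coeffBound c
  set Q := max 1 (n : ℝ) / min 1 ε with hQ
  have hmin : 0 < min 1 ε := lt_min one_pos hε
  have hQ1 : 1 ≤ Q := by
    rw [hQ, one_le_div hmin]
    exact (min_le_left _ _).trans (le_max_left _ _)
  -- The constant 81 is `1 + 40 * 2`, since `(n + 1) / ε ≤ 2 * Q` and `1 ≤ coeffBound c * Q`.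
  have h1 : 1 / stepSize c n ε = 1 + 40 * coeffBound c * ((n + 1) / ε) := by
    unfold stepSize
    field_simp
  have h2 : ((n : ℝ) + 1) / ε ≤ 2 * Q := by
    rw [hQ, ← mul_div_assoc]
    gcongr
    · linarith [le_max_left 1 (n : ℝ), le_max_right 1 (n : ℝ)]
    · exact min_le_right _ _
  have h3 : 1 ≤ coeffBound c * Q := one_le_mul_of_one_le_of_one_le hG hQ1
  rw [h1]
  have h4 : coeffBound c * ((n + 1) / ε) ≤ coeffBound c * (2 * Q) := by gcongr
  nlinarith

end StepSize

/-- A packed weight has `L` digits and is below the `L`-th power of the base. This is where `L`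
enters the exponent of the running time. -/
theorem one_add_sum_packWeight_le {n L M : ℕ} {δ : ℝ} (α : Fin n → Fin L → ℂ)
    (hM : ∀ e k, spiralIndex δ (α e k) ≤ M) :
    1 + ∑ e, packWeight δ α e ≤ 1 + n * (2 + n * (L * M)) ^ L := by
  have hB : packBase δ α ≤ 2 + n * (L * M) := by
    unfold packBase
    gcongr
    calc ∑ e, ∑ k, spiralIndex δ (α e k) ≤ ∑ _e : Fin n, ∑ _k : Fin L, M :=
          Finset.sum_le_sum fun e _ => Finset.sum_le_sum fun k _ => hM e k
      _ = n * (L * M) := by simp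
  gcongr
  calc ∑ e, packWeight δ α e ≤ ∑ _e : Fin n, (2 + n * (L * M)) ^ L := by
        refine Finset.sum_le_sum fun e _ => ?_
        have h := Nat.ofDigits_lt_base_pow_length (b := packBase δ α)
          (l := List.ofFn fun k => spiralIndex δ (α e k)) (by unfold packBase; omega) (by
            intro x hx
            rw [List.mem_ofFn] at hx
            obtain ⟨k, rfl⟩ := hx
            have h1 : spiralIndex δ (α e k) ≤ ∑ k, spiralIndex δ (α e k) :=
              Finset.single_le_sum (f := fun k => spiralIndex δ (α e k))
                (fun _ _ => Nat.zero_le _) (Finset.mem_univ k)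
            have h2 : ∑ k, spiralIndex δ (α e k) ≤ ∑ e, ∑ k, spiralIndex δ (α e k) :=
              Finset.single_le_sum (f := fun e => ∑ k, spiralIndex δ (α e k))
                (fun _ _ => Nat.zero_le _) (Finset.mem_univ e)
            unfold packBase
            omega)
        rw [List.length_ofFn] at h
        exact h.le.trans (Nat.pow_le_pow_left hB L)
    _ = n * (2 + n * (L * M)) ^ L := by simp

theorem runningTime_le {n L M X T a d t : ℕ} {Z : ℝ} (hZ : 1 ≤ Z) (hn : (n : ℝ) ≤ Z)
    (hL : (L : ℝ) ≤ Z) (hM : (M : ℝ) + 1 ≤ Z) (hX : (n : ℝ) + X + 1 ≤ Z)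
    (hT : T ≤ a * (n + X + 1) ^ d)
    (ht : t ≤ (X + 1) * (T + n * (T + n * 41 + L * 250 + 550) + L * 100 + 550)
      + n * (L * ((M + 1) * 500) + 300) + L * 100 + 500) :
    (t : ℝ) ≤ 3000 * (1 + a) * Z ^ (d + 3) := by
  have hT' : (T : ℝ) ≤ a * Z ^ d := by
    calc (T : ℝ) ≤ a * ((n : ℝ) + X + 1) ^ d := by exact_mod_cast hT
      _ ≤ a * Z ^ d := by gcongr
  have hX' : (X : ℝ) + 1 ≤ Z := by
    have : (0 : ℝ) ≤ n := Nat.cast_nonneg n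
    linarith
  set τ : ℝ := a * Z ^ d
  have hτ : 0 ≤ τ := by positivity
  have hZ0 : 0 ≤ Z := by linarith
  have ht' : (t : ℝ) ≤ ((X : ℝ) + 1) * (T + n * (T + n * 41 + L * 250 + 550) + L * 100 + 550)
      + n * (L * ((M + 1) * 500) + 300) + L * 100 + 500 := by exact_mod_cast ht
  have h1 : (t : ℝ) ≤ Z * (τ + Z * (τ + Z * 41 + Z * 250 + 550) + Z * 100 + 550)
      + Z * (Z * (Z * 500) + 300) + Z * 100 + 500 := by
    refine ht'.trans ?_
    gcongr
  have p1 : Z ≤ Z ^ 3 := le_self_pow₀ hZ (by norm_num)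
  have p2 : Z ^ 2 ≤ Z ^ 3 := pow_le_pow_right₀ hZ (by norm_num)
  have p0 : 1 ≤ Z ^ 3 := one_le_pow₀ hZ
  have q1 : Z * τ ≤ Z ^ 3 * τ := by gcongr
  have q2 : Z ^ 2 * τ ≤ Z ^ 3 * τ := by gcongr
  have h2 : (t : ℝ) ≤ 3000 * (Z ^ 3 + Z ^ 3 * τ) := by
    have q3 : 0 ≤ Z ^ 3 * τ := by positivity
    nlinarith
  have h3 : Z ^ 3 ≤ Z ^ (d + 3) := pow_le_pow_right₀ hZ (by omega)
  have h4 : Z ^ 3 * τ = a * Z ^ (d + 3) := by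
    rw [pow_add]
    ring
  rw [h4] at h2
  linarith

/-- The packing base is `O(Q ^ 4)`, one factor from `n` and three from `M`, so `X` is `O(Q ^ (4 * L
+ 1))`; for `1 ≤ L` this is covered by `Q ^ (5 * L)`. -/
theorem exists_sizeBound {L : ℕ} (hL : 1 ≤ L) {G : ℝ} (hG : 1 ≤ G) :
    ∃ C : ℝ, 1 ≤ C ∧ ∀ (Q : ℝ) (n M X : ℕ), 1 ≤ Q → (n : ℝ) ≤ Q → (M : ℝ) ≤ 18 * (G * Q) ^ 3 →
      X ≤ 1 + n * (2 + n * (L * M)) ^ L →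
      1 ≤ C * Q ^ (5 * L) ∧ (n : ℝ) ≤ C * Q ^ (5 * L) ∧ (L : ℝ) ≤ C * Q ^ (5 * L) ∧
        (M : ℝ) + 1 ≤ C * Q ^ (5 * L) ∧ (n : ℝ) + X + 1 ≤ C * Q ^ (5 * L) := by
  set m : ℝ := 18 * G ^ 3
  have hm : 0 ≤ m := by positivity
  set B : ℝ := 2 + L * m
  have hB : 0 ≤ B := by positivity
  refine ⟨3 + L + m + B ^ L, ?_, fun Q n M X hQ hn hM hX => ?_⟩
  · have : (0 : ℝ) ≤ L := Nat.cast_nonneg L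
    have : 0 ≤ B ^ L := by positivity
    linarith
  · have hL0 : (0 : ℝ) ≤ L := Nat.cast_nonneg L
    have hBL : 0 ≤ B ^ L := by positivity
    have hQ0 : 0 ≤ Q := by linarith
    set R := Q ^ (5 * L)
    have hR1 : 1 ≤ R := one_le_pow₀ hQ
    have hQR : Q ≤ R := le_self_pow₀ hQ (by omega)
    have hM' : (M : ℝ) ≤ m * Q ^ 3 := by
      calc (M : ℝ) ≤ 18 * (G * Q) ^ 3 := hM
        _ = m * Q ^ 3 := by ring
    have hMR : (M : ℝ) ≤ m * R := by
      refine hM'.trans ?_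
      gcongr
      exact pow_le_pow_right₀ hQ (by omega)
    have hbase : (2 : ℝ) + n * (L * M) ≤ B * Q ^ 4 := by
      have h1 : (n : ℝ) * (L * M) ≤ Q * (L * (m * Q ^ 3)) := by gcongr
      have h2 : (1 : ℝ) ≤ Q ^ 4 := one_le_pow₀ hQ
      calc (2 : ℝ) + n * (L * M) ≤ 2 * Q ^ 4 + Q * (L * (m * Q ^ 3)) := by linarith
        _ = B * Q ^ 4 := by ring
    have hX' : (X : ℝ) ≤ 1 + B ^ L * R := by
      calc (X : ℝ) ≤ 1 + n * (2 + n * (L * M)) ^ L := by exact_mod_cast hX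
        _ ≤ 1 + Q * (B * Q ^ 4) ^ L := by gcongr
        _ = 1 + B ^ L * Q ^ (4 * L + 1) := by rw [mul_pow, ← pow_mul]; ring
        _ ≤ 1 + B ^ L * R := by
          gcongr
          exact pow_le_pow_right₀ hQ (by omega)
    have e1 : 0 ≤ m * R := by positivity
    have e2 : 0 ≤ L * R := by positivity
    have e3 : 0 ≤ B ^ L * R := by positivity
    have e4 : (L : ℝ) ≤ L * R := le_mul_of_one_le_right hL0 hR1
    have e5 : (3 + L + m + B ^ L) * R = 3 * R + L * R + m * R + B ^ L * R := by ring
    rw [e5]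
    refine ⟨?_, ?_, ?_, ?_, ?_⟩ <;> linarith

/-! ### The main theorem. -/

theorem theorem3 (A : CombProblem.{u}) (hA : ExactPseudopoly A) :
    -- `D` is the constant in the exponent `O(L)`
    ∃ D : ℕ, ∀ L : ℕ, 1 ≤ L → ∃ p : Prog,
      ∀ (c φ : Fin L → ℂ) (θ : Fin L → ℝ),
        (∀ k, ‖φ k‖ ≤ 1) →
        (∀ k, φ k = (‖φ k‖ : ℂ) * Complex.exp (θ k * Complex.I)) →
        ∃ C : ℝ, ∀ ε : ℝ, 0 < ε →
          ∀ (i : A.Inst), (A.feas i).Nonempty →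
          ∀ (Ω : Type v) [MeasurableSpace Ω] (P : Measure Ω) [IsProbabilityMeasure P]
            (w : Fin (A.n i) → Ω → ℝ),
            (∀ e, Measurable (w e)) → (∀ e, ∀ᵐ ω ∂P, 0 ≤ w e ω) → iIndepFun w P →
            ∃ (S : Finset (Fin (A.n i))) (t : ℕ),
              Runs p (eumInput P A i w c φ θ ε) (.ofSet S) t ∧
              (t : ℝ) ≤ C * (max 1 (A.n i : ℝ) / min 1 ε) ^ (D * L) ∧
              S ∈ A.feas i ∧
              ∀ T ∈ A.feas i,
                IsMaxOn (fun S' => ‖expectedUtility P w (expSum c φ θ) S'‖) (A.feas i) T →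
                |‖expectedUtility P w (expSum c φ θ) S‖ -
                  ‖expectedUtility P w (expSum c φ θ) T‖| < ε := by
  obtain ⟨p, a, d, hp⟩ := hA
  -- All sizes are at most `C * Q ^ (5 * L)`, and the time has degree `d + 3` in them: `d` from the
  -- oracle and 3 from the surrounding loops.
  refine ⟨5 * (d + 3), fun L hL => ⟨Prog.maximizeUtility p, fun c φ θ hφ _ => ?_⟩⟩
  have hG := one_le_coeffBound c
  obtain ⟨C, hC, hsize⟩ := exists_sizeBound hL (G := 81 * coeffBound c) (by linarith)
  refine ⟨3000 * (1 + a) * C ^ (d + 3), fun ε hε i hF Ω _ P _ w hw hw0 hind => ?_⟩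
  set α : Fin (A.n i) → Fin L → ℂ := fun e k => ∫ ω, powArg (φ k) (θ k) (w e ω) ∂P with hαdef
  have hα : ∀ e k, ‖α e k‖ ≤ 1 := fun e k => norm_integral_powArg_le_one (hφ k) _ (hw0 e)
  set δ := stepSize c (A.n i) ε with hδ
  have h0 : 0 < δ := stepSize_pos c (A.n i) hε
  have h1 : δ ≤ 1 := stepSize_le_one c (A.n i) hε
  set Q := max 1 (A.n i : ℝ) / min 1 ε with hQ
  have hmin : 0 < min 1 ε := lt_min one_pos hε
  have hnQ : max 1 (A.n i : ℝ) ≤ Q := by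
    rw [hQ, le_div_iff₀ hmin]
    exact mul_le_of_le_one_right (by positivity) (min_le_left _ _)
  set M := ⌊18 / δ ^ 3⌋₊
  have hM : ∀ e k, spiralIndex δ (α e k) ≤ M := fun e k =>
    Nat.le_floor (spiralIndex_spec h0 h1 (hα e k)).2
  have hMQ : (M : ℝ) ≤ 18 * (81 * coeffBound c * Q) ^ 3 := by
    calc (M : ℝ) ≤ 18 / δ ^ 3 := Nat.floor_le (by positivity)
      _ = 18 * (1 / δ) ^ 3 := by rw [one_div, inv_pow]; rfl
      _ ≤ _ := by
        gcongr
        exact inv_stepSize_le c (A.n i) hε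
  set X := 1 + ∑ e, packWeight δ α e
  have hor : IsOracle p (A.feas i) (A.descr i) X (a * (A.n i + X + 1) ^ d) := by
    intro w' K hK hw'
    obtain ⟨r, t, hr, hr', ht⟩ := hp i w' K
    have e : Val.ofNats (List.ofFn w') = .ofSeq fun e => .num (w' e : ℝ) :=
      (Val.ofSeq_eq_map Val.ofNat w').symm
    refine ⟨r, ⟨t, ht.trans ?_, by rw [e]; exact hr⟩, hr'⟩
    have hmax : max K (Finset.univ.sup w') ≤ X := max_le hK (Finset.sup_le fun e _ => hw' e)
    gcongr
  obtain ⟨S, hS, hbest, t, ht, hrun⟩ := Prog.runsIn_maximizeUtility c α hδ h0 h1 hα hM hF hor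
  obtain ⟨z1, z2, z3, z4, z5⟩ := hsize Q (A.n i) M X ((le_max_left _ _).trans hnQ)
    ((le_max_right _ _).trans hnQ) hMQ (one_add_sum_packWeight_le α hM)
  refine ⟨S, t, hrun, ?_, hS, fun T hT hmax => ?_⟩
  · refine (runningTime_le z1 z2 z3 z4 z5 le_rfl ht).trans (le_of_eq ?_)
    rw [mul_pow, ← pow_mul]
    ring
  · have hval : ∀ U, expectedUtility P w (expSum c φ θ) U = solutionValue c α U :=
      expectedUtility_expSum hw hw0 hind c φ θ hφ
    simp only [hval]
    have hST : ‖solutionValue c α S‖ ≤ ‖solutionValue c α T‖ := by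
      simpa only [hval, Set.mem_ofPred_eq] using hmax hS
    -- The representative `S'` of the weight of the optimum `T` links the two: it is no better than
    -- `S` and, having the same digit sums as `T`, within `ε` of `T`.
    obtain ⟨S', hS', hsum, hle⟩ := hbest T hT
    have hdigits : ∀ k, ∑ e ∈ S', spiralIndex δ (α e k) = ∑ e ∈ T, spiralIndex δ (α e k) := by
      refine sum_digit_eq_of_sum_ofDigits_eq (B := packBase δ α) (by unfold packBase; omega)
        (fun e k => spiralIndex δ (α e k)) (fun k => ?_) S' T hsum
      have : ∑ e, spiralIndex δ (α e k) ≤ ∑ e, ∑ k, spiralIndex δ (α e k) :=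
        Finset.sum_le_sum fun e _ => Finset.single_le_sum
          (f := fun k => spiralIndex δ (α e k)) (fun _ _ => Nat.zero_le _) (Finset.mem_univ k)
      unfold packBase
      omega
    have hclose := (norm_solutionValue_sub_le c α h0 h1 hα S' T hdigits).trans_lt
      (sum_norm_mul_stepSize_lt c (A.n i) hε)
    have htri := norm_sub_norm_le (solutionValue c α T) (solutionValue c α S')
    rw [norm_sub_rev] at hclose
    rw [abs_sub_comm, abs_of_nonneg (by linarith)]
    linarith
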